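/- We work over $\mathbb{C}$. A surface $X$ of degree $d$ in $\mathbb{P}^3$ is the zero scheme of a nonzero form $f$ of degree $d$ (irreducibility need not be assumed in advance). A smooth point $P$ of $X$ is a \emph{star point} if the scheme $T_P(X)\cap X$ is a cone with vertex $P$, where $T_P(X)$ is the embedded tangent plane. A point of $X$ is a singularity of type $A_n$ ($n\ge 1$) if in suitable formal local coordinates of $\mathbb{P}^3$ centred at that point $X$ has the equation $z_0^2+z_1^2+z_2^{n+1}=0$. \textbf{Theorem.} Let $X$ be a surface of degree $d\ge 3$ in $\mathbb{P}^3$, let $\Lambda\not\subset\operatorname{Sing}(X)$ be a line containing (at least) $d-1$ distinct singularities of $X$ of type $A_{d-1}$, and let $P\in\Lambda$ be a smooth star point of $X$. Then there is an algebraic one-parameter family of triples $(X(t),\Lambda(t),P(t))$, $t\in\mathbb{C}$, each consisting of a surface of degree $d$ in $\mathbb{P}^3$, a line in $\mathbb{P}^3$ and a point of $\mathbb{P}^3$, all depending polynomially on $t$, with $$(X(0),\Lambda(0),P(0))=(X,\Lambda,P),$$ such that for every $t\ne 0$ the surface $X(t)$ is irreducible and reduced, the line $\Lambda(t)$ contains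 exactly $d-1$ singularities of $X(t)$ of type $A_{d-2}$, and $P(t)$ is a smooth star point of $X(t)$ lying on $\Lambda(t)$. -/

import Mathlib

open scoped LinearAlgebra.Projectivization

noncomputable section

/-- The coordinate space `ℂ⁴`; its projectivization is `ℙ³`. -/
abbrev V4 : Type := Fin 4 → ℂ

/-- The complex projective space `ℙ³`. -/
abbrev P3 : Type := ℙ ℂ V4

/-- The point `P` of `ℙ³` lies on the projectivization of the linear subspace `L` of `ℂ⁴`
(for a line of `ℙ³`, `L` has dimension two). -/
def LiesOn (P : P3) (L : Submodule ℂ V4) : Prop :=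
  P.submodule ≤ L

/-- `P` is a singular point of the surface `f = 0` (for `f` homogeneous this does not depend on the
chosen representative of `P`, and the same holds for all definitions below). -/
def IsSingularPoint (f : MvPolynomial (Fin 4) ℂ) (P : P3) : Prop :=
  MvPolynomial.eval P.rep f = 0 ∧ ∀ i, MvPolynomial.eval P.rep (MvPolynomial.pderiv i f) = 0

/-- `P` is a smooth point of the surface `f = 0`. -/
def IsSmoothPoint (f : MvPolynomial (Fin 4) ℂ) (P : P3) : Prop :=
  MvPolynomial.eval P.rep f = 0 ∧ ∃ i, MvPolynomial.eval P.rep (MvPolynomial.pderiv i f) ≠ 0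

/-- The embedded tangent space at `P` of the surface `f = 0`, given by `∑ᵢ ∂ᵢf(P) Xᵢ = 0`. -/
def tangentSpaceAt (f : MvPolynomial (Fin 4) ℂ) (P : P3) : Submodule ℂ V4 :=
  LinearMap.ker (∑ i, MvPolynomial.eval P.rep (MvPolynomial.pderiv i f) •
    (LinearMap.proj i : V4 →ₗ[ℂ] ℂ))

/-- The intersection of the surface `f = 0` with the linear subspace `T` is, as a scheme, a cone with
vertex `P` (a point of `T`): the restriction of the form `f` to `T` is invariant under translation
in the direction `P`, i.e. it only involves linear forms on `T` that vanish at `P`. -/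
def IsConeWithVertex (f : MvPolynomial (Fin 4) ℂ) (T : Submodule ℂ V4) (P : P3) : Prop :=
  LiesOn P T ∧
    ∀ v ∈ T, ∀ c : ℂ, MvPolynomial.eval (v + c • P.rep) f = MvPolynomial.eval v f

/-- `P` is a smooth star point of the surface `f = 0`. -/
def IsSmoothStarPoint (f : MvPolynomial (Fin 4) ℂ) (P : P3) : Prop :=
  IsSmoothPoint f P ∧ IsConeWithVertex f (tangentSpaceAt f P) P

/-- The equation `f(p + x₀ v₀ + x₁ v₁ + x₂ v₂)` of the surface `f = 0` in the affine chart
`x ↦ p + x₀ v₀ + x₁ v₁ + x₂ v₂` of `ℙ³`, where `p` is a representative of `P`. If `p, v₀, v₁, v₂` is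
a basis of `ℂ⁴`, this is a chart whose origin is `P`. -/
def localEquation (f : MvPolynomial (Fin 4) ℂ) (P : P3) (v : Fin 3 → V4) :
    MvPolynomial (Fin 3) ℂ :=
  MvPolynomial.bind₁ (fun i => MvPolynomial.C (P.rep i) +
    ∑ j, MvPolynomial.C (v j i) * MvPolynomial.X j) f

/-- `z₀, z₁, z₂` is a system of formal local coordinates at the origin of `ℂ³`: the `zᵢ` vanish at
the origin and their Jacobian determinant does not. -/
def IsFormalCoordinates (z : Fin 3 → MvPowerSeries (Fin 3) ℂ) : Prop :=
  (∀ i, MvPowerSeries.constantCoeff (z i) = 0) ∧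
    (Matrix.of fun i j => MvPowerSeries.coeff (Finsupp.single j 1) (z i)).det ≠ 0

/-- `P` is a singularity of type `A_n` (`n ≥ 1`) of the surface `f = 0`: in suitable formal local
coordinates at `P` the surface has equation `z₀² + z₁² + z₂ⁿ⁺¹ = 0`, that is, this series is a unit
times the local equation of the surface in an affine chart centred at `P`. -/
def IsTypeA (n : ℕ) (f : MvPolynomial (Fin 4) ℂ) (P : P3) : Prop :=
  ∃ v : Fin 3 → V4, LinearIndependent ℂ (Fin.cons P.rep v : Fin 4 → V4) ∧
    ∃ (z : Fin 3 → MvPowerSeries (Fin 3) ℂ) (u : MvPowerSeries (Fin 3) ℂ),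
      IsFormalCoordinates z ∧ IsUnit u ∧
        u * (localEquation f P v : MvPowerSeries (Fin 3) ℂ) = z 0 ^ 2 + z 1 ^ 2 + z 2 ^ (n + 1)

/-- The set of singularities of type `A_n` of the surface `f = 0` lying on `L`. -/
def typeAOn (n : ℕ) (f : MvPolynomial (Fin 4) ℂ) (L : Submodule ℂ V4) : Set P3 :=
  {Q | LiesOn Q L ∧ IsTypeA n f Q}

/-- An algebraic one-parameter family, parametrized by the affine line, of triples consisting of a
surface of degree `d`, a line and a point in `ℙ³`: the coefficients of the equation, two spanning
vectors of the line, and the homogeneous coordinates of the point are polynomials in the parameter,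
and for no value of the parameter they degenerate. -/
structure TripleFamily (d : ℕ) where
  form : MvPolynomial (Fin 4) (Polynomial ℂ)
  isHomogeneous : form.IsHomogeneous d
  form_ne_zero : ∀ t : ℂ, MvPolynomial.map (Polynomial.evalRingHom t) form ≠ 0
  lineVec : Fin 2 → Fin 4 → Polynomial ℂ
  line_indep : ∀ t : ℂ,
    LinearIndependent ℂ (fun k => (fun i => (lineVec k i).eval t : V4))
  pointVec : Fin 4 → Polynomial ℂ
  point_ne_zero : ∀ t : ℂ, (fun i => (pointVec i).eval t : V4) ≠ 0

namespace TripleFamily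

variable {d : ℕ}

/-- The equation of the surface `X(t)`. -/
def X (F : TripleFamily d) (t : ℂ) : MvPolynomial (Fin 4) ℂ :=
  MvPolynomial.map (Polynomial.evalRingHom t) F.form

/-- The line `Λ(t)`. -/
def line (F : TripleFamily d) (t : ℂ) : Submodule ℂ V4 :=
  Submodule.span ℂ (Set.range fun k => (fun i => (F.lineVec k i).eval t : V4))

/-- The point `P(t)`. -/
def point (F : TripleFamily d) (t : ℂ) : P3 :=
  Projectivization.mk ℂ (fun i => (F.pointVec i).eval t : V4) (F.point_ne_zero t)

end TripleFamily

end

/-!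
The derivative `∂_P f` has degree `d - 1` and vanishes on `Λ` at `P` and at the `d - 1`
singularities, hence on all of `Λ`, so `Λ` lies on the surface and in the tangent plane at `P`.
Choose a basis `e₀ = P, e₁, e₂, e₃` of `ℂ⁴` such that `e₀, e₁` span the line and `e₀, e₁, e₂` the
tangent plane. The form `∂₃f` has degree `d - 1` and does not vanish at `P`, so its zeros on the
line are precisely the singularities, and they are simple: the mixed derivative `∂₀∂₃f` is nonzero
there.

Near a singularity `Q` the surface is `X₂ G + H(X₁) = 0` in coordinates along `e₀, e₂, e₃`, where
`H` does not involve `X₀` because `P` is a star point, and `X₂, G, X₁` are formal coordinates.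
Type `A_{d-1}` therefore means that `X₁` divides `H` exactly `d` times or, in view of the degree,
that `H = c X₁ᵈ`. Adding `t x₂ᵈ⁻¹ x₁` to `f` turns `H` into `X₁ᵈ⁻¹ (t β + c X₁)` with `β ≠ 0`, which
gives type `A_{d-2}` at the same `d - 1` points, and `P` remains a smooth star point. A
factorization of the new form would restrict to the tangent plane as a factorization of a nonzero
form independent of `x₀`; both factors would then vanish at `P`, which is a smooth point.
-/

noncomputable section

section LocalRing

open IsLocalRing

theorem det_ne_zero_of_isotropic {K : Type*} [CommRing K] [IsDomain K] {b₀ b₁ c₀ c₁ : K}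
    (h₀ : b₀ * b₀ + b₁ * b₁ = 0) (h₁ : b₀ * c₀ + b₁ * c₁ ≠ 0) : b₀ * c₁ - b₁ * c₀ ≠ 0 := by
  intro h
  have e₀ : (b₀ * c₀ + b₁ * c₁) * b₀ = 0 := by linear_combination c₀ * h₀ + b₁ * h
  have e₁ : (b₀ * c₀ + b₁ * c₁) * b₁ = 0 := by linear_combination c₁ * h₀ - b₀ * h
  exact h₁ (by rw [(mul_eq_zero.1 e₀).resolve_left h₁, (mul_eq_zero.1 e₁).resolve_left h₁]; ring)

theorem dvd_and_dvd_of_isUnit_det {S : Type*} [CommRing S] {y s t a b c d : S}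
    (hdet : IsUnit (a * d - b * c)) (h₁ : y ∣ s * a + t * b) (h₂ : y ∣ s * c + t * d) :
    y ∣ s ∧ y ∣ t := by
  rw [← hdet.dvd_mul_right (b := s), ← hdet.dvd_mul_right (b := t)]
  refine ⟨?_, ?_⟩
  · convert dvd_sub (h₁.mul_left d) (h₂.mul_left b) using 1
    ring
  · convert dvd_sub (h₂.mul_left a) (h₁.mul_left c) using 1
    ring

theorem mul_derivation_eq {A R : Type*} [CommRing A] [CommRing R] [Algebra A R] {n : ℕ} {F u : R}
    {z : Fin 3 → R} (h : u * F = z 0 ^ 2 + z 1 ^ 2 + z 2 ^ (n + 1)) (D : Derivation A R R) :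
    u * D F = 2 * (z 0 * D (z 0) + z 1 * D (z 1)) + (n + 1) * z 2 ^ n * D (z 2) - F * D u := by
  have hD := congrArg D h
  simp only [Derivation.leibniz, Derivation.leibniz_pow, map_add, smul_eq_mul, nsmul_eq_mul,
    Nat.add_sub_cancel, Nat.cast_succ, Nat.reduceSub, pow_one] at hD
  linear_combination hD

variable {R : Type*} [CommRing R] [IsLocalRing R]

/-- `F` is, up to a unit, of the form `z₀² + z₁² + z₂ⁿ⁺¹` with `zᵢ` in the maximal ideal of a local
ring. The `zᵢ` need not be coordinates, so that this notion, unlike `IsTypeA`, is stable under all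
local homomorphisms. -/
def IsTypeAGerm (n : ℕ) (F : R) : Prop :=
  ∃ (z : Fin 3 → R) (u : R), (∀ i, z i ∈ maximalIdeal R) ∧ IsUnit u ∧
    u * F = z 0 ^ 2 + z 1 ^ 2 + z 2 ^ (n + 1)

variable {n : ℕ} {F : R}

theorem IsTypeAGerm.map {S : Type*} [CommRing S] [IsLocalRing S] (h : IsTypeAGerm n F)
    (φ : R →+* S) [IsLocalHom φ] : IsTypeAGerm n (φ F) := by
  obtain ⟨z, u, hz, hu, h⟩ := h
  exact ⟨fun i => φ (z i), φ u, fun i => (mem_maximalIdeal _).2 fun hi =>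
    hz i (isUnit_of_map_unit φ _ hi), hu.map φ, by simp only [← map_pow, ← map_add, ← map_mul, h]⟩

theorem IsTypeAGerm.isUnit_mul (h : IsTypeAGerm n F) {s : R} (hs : IsUnit s) :
    IsTypeAGerm n (s * F) := by
  obtain ⟨z, u, hz, hu, h⟩ := h
  obtain ⟨s, rfl⟩ := hs
  exact ⟨z, u * ↑s⁻¹, hz, hu.mul s⁻¹.isUnit, by rw [mul_assoc, s.inv_mul_cancel_left, h]⟩

theorem IsTypeAGerm.mem_maximalIdeal (h : IsTypeAGerm n F) : F ∈ maximalIdeal R := by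
  obtain ⟨z, u, hz, hu, h⟩ := h
  rw [← Ideal.unit_mul_mem_iff_mem _ hu, h]
  exact add_mem (add_mem (Ideal.pow_mem_of_mem _ (hz 0) 2 two_pos)
    (Ideal.pow_mem_of_mem _ (hz 1) 2 two_pos)) (Ideal.pow_mem_of_mem _ (hz 2) _ n.succ_pos)

variable {A : Type*} [CommRing A] [Algebra A R]

theorem IsTypeAGerm.derivation_mem_maximalIdeal (h : IsTypeAGerm n F) (hn : 1 ≤ n)
    (D : Derivation A R R) : D F ∈ maximalIdeal R := by
  have hF := h.mem_maximalIdeal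
  obtain ⟨z, u, hz, hu, h⟩ := h
  rw [← Ideal.unit_mul_mem_iff_mem _ hu, mul_derivation_eq h]
  refine sub_mem (add_mem (Ideal.mul_mem_left _ _ (add_mem ?_ ?_)) ?_) (Ideal.mul_mem_right _ _ hF)
  · exact Ideal.mul_mem_right _ _ (hz 0)
  · exact Ideal.mul_mem_right _ _ (hz 1)
  · exact Ideal.mul_mem_right _ _ (Ideal.mul_mem_left _ _ (Ideal.pow_mem_of_mem _ (hz 2) n hn))

section Hessian

variable {z : Fin 3 → R} {u : R} (hn : 2 ≤ n) (hz : ∀ i, z i ∈ maximalIdeal R) (hu : IsUnit u)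
  (h : u * F = z 0 ^ 2 + z 1 ^ 2 + z 2 ^ (n + 1)) {D D' : Derivation A R R}

include hn hz hu h

theorem residue_hessian (D D' : Derivation A R R) :
    residue R u * residue R (D (D' F)) = residue R 2 * (residue R (D (z 0)) * residue R (D' (z 0)) +
      residue R (D (z 1)) * residue R (D' (z 1))) := by
  have hgerm : IsTypeAGerm n F := ⟨z, u, hz, hu, h⟩
  have hF := (residue_eq_zero_iff _).2 hgerm.mem_maximalIdeal
  have hDF (E : Derivation A R R) :=
    (residue_eq_zero_iff _).2 (hgerm.derivation_mem_maximalIdeal (by lia) E)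
  have hz' i := (residue_eq_zero_iff _).2 (hz i)
  have hn' : n ≠ 0 := by lia
  have hn'' : n - 1 ≠ 0 := by lia
  have hDD := congrArg (fun a => residue R (D a)) (mul_derivation_eq h D')
  simpa [Derivation.leibniz, Derivation.leibniz_pow, hF, hDF, hz', hn', hn'', mul_comm] using hDD

theorem isUnit_two_and_isUnit_jacobian (hDD : D (D F) ∈ maximalIdeal R)
    (hDD' : D (D' F) ∉ maximalIdeal R) :
    IsUnit (2 : R) ∧ IsUnit (D (z 0) * D' (z 1) - D (z 1) * D' (z 0)) := by
  rw [← residue_eq_zero_iff] at hDD hDD'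
  have hess := residue_hessian hn hz hu h D D
  have hess' := residue_hessian hn hz hu h D D'
  have hne := hess' ▸ mul_ne_zero ((residue_ne_zero_iff_isUnit u).2 hu) hDD'
  have h2 := left_ne_zero_of_mul hne
  rw [hDD, mul_zero, eq_comm, mul_eq_zero, or_iff_right h2] at hess
  refine ⟨(residue_ne_zero_iff_isUnit _).1 h2, (residue_ne_zero_iff_isUnit _).1 ?_⟩
  simpa using det_ne_zero_of_isotropic hess (right_ne_zero_of_mul hne)

end Hessian

/- The Hessian conditions make the Jacobian of `z₀, z₁` along `D, D'` a unit. Since the derivatives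
of `z₀² + z₁² + z₂ⁿ⁺¹` are divisible by `xᵐ`, so are `z₀` and `z₁` by Cramer's rule, and their
squares are divisible by `x²ᵐ`. -/
theorem IsTypeAGerm.pow_succ_dvd {S : Type*} [CommRing S] (h : IsTypeAGerm n F) (hn : 2 ≤ n)
    {m : ℕ} (hm : 1 ≤ m) (hmn : m ≤ n) {D D' : Derivation A R R}
    (hDD : D (D F) ∈ maximalIdeal R) (hDD' : D (D' F) ∉ maximalIdeal R) {π : R →+* S} {x : S}
    (hx : ∀ a ∈ maximalIdeal R, x ∣ π a) (hF : x ^ m ∣ π F) (hDF : x ^ m ∣ π (D F))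
    (hD'F : x ^ m ∣ π (D' F)) : x ^ (m + 1) ∣ π F := by
  obtain ⟨z, u, hz, hu, h⟩ := h
  obtain ⟨h2, hjac⟩ := isUnit_two_and_isUnit_jacobian hn hz hu h hDD hDD'
  have hlin (E : Derivation A R R) (hE : x ^ m ∣ π (E F)) :
      x ^ m ∣ π (z 0) * π (E (z 0)) + π (z 1) * π (E (z 1)) := by
    have heq : 2 * (z 0 * E (z 0) + z 1 * E (z 1)) =
        u * E F + F * E u - z 2 ^ n * ((n + 1) * E (z 2)) := by
      linear_combination -mul_derivation_eq h E
    have hz2 : x ^ m ∣ π (z 2) ^ n := (pow_dvd_pow x hmn).trans (pow_dvd_pow_of_dvd (hx _ (hz 2)) n)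
    rw [← map_mul, ← map_mul, ← map_add, ← (h2.map π).dvd_mul_left, ← map_mul, heq, map_sub,
      map_add, map_mul, map_mul, map_mul, map_pow]
    exact dvd_sub (dvd_add (hE.mul_left _) (hF.mul_right _)) (hz2.mul_right _)
  obtain ⟨hz0, hz1⟩ := dvd_and_dvd_of_isUnit_det (by simpa using hjac.map π) (hlin D hDF)
    (hlin D' hD'F)
  have hsq {a : S} (ha : x ^ m ∣ a) : x ^ (m + 1) ∣ a ^ 2 :=
    (pow_dvd_pow x (by lia : m + 1 ≤ m * 2)).trans (pow_mul x m 2 ▸ pow_dvd_pow_of_dvd ha 2)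
  rw [← (hu.map π).dvd_mul_left, ← map_mul, h, map_add, map_add, map_pow, map_pow, map_pow]
  exact dvd_add (dvd_add (hsq hz0) (hsq hz1))
    ((pow_dvd_pow x (by lia)).trans (pow_dvd_pow_of_dvd (hx _ (hz 2)) _))

end LocalRing

section PowerSeries

open MvPowerSeries

theorem exists_eq_sum_X_mul {σ R : Type*} [Fintype σ] [CommSemiring R] {φ : MvPowerSeries σ R}
    (hφ : constantCoeff φ = 0) : ∃ g : σ → MvPowerSeries σ R, φ = ∑ i, X i * g i := by
  classical
  rcases isEmpty_or_nonempty σ with _ | _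
  · exact ⟨0, ext fun m => by simpa [Subsingleton.elim m 0] using hφ⟩
  have hex (m : σ →₀ ℕ) : m ≠ 0 → ∃ i, m i ≠ 0 := Finsupp.ne_iff.1
  choose! s hs using hex
  obtain ⟨g, hg⟩ : ∃ g : σ → MvPowerSeries σ R, ∀ i m, coeff m (g i) =
      if s (m + Finsupp.single i 1) = i then coeff (m + Finsupp.single i 1) φ else 0 :=
    ⟨fun i m => _, fun i m => rfl⟩
  refine ⟨g, ext fun m => ?_⟩
  simp only [map_sum, X, coeff_monomial_mul, one_mul, Finsupp.single_le_iff, hg]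
  rcases eq_or_ne m 0 with rfl | hm
  · simpa using hφ
  · have hsm : 1 ≤ m (s m) := Nat.one_le_iff_ne_zero.2 (hs m hm)
    rw [Finset.sum_eq_single (s m)]
    · rw [if_pos hsm, tsub_add_cancel_of_le (Finsupp.single_le_iff.2 hsm), if_pos rfl]
    · intro i _ hi
      split_ifs with hmi h
      · rw [tsub_add_cancel_of_le (Finsupp.single_le_iff.2 hmi)] at h
        exact absurd h.symm hi
      all_goals rfl
    · simp

variable {K : Type*} [Field K]

theorem mem_maximalIdeal_iff_constantCoeff {σ : Type*} {φ : MvPowerSeries σ K} :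
    φ ∈ IsLocalRing.maximalIdeal (MvPowerSeries σ K) ↔ constantCoeff φ = 0 := by
  rw [IsLocalRing.mem_maximalIdeal, mem_nonunits_iff, isUnit_iff_constantCoeff, isUnit_iff_ne_zero,
    not_not]

variable {G : MvPowerSeries (Fin 3) K} (hG : constantCoeff G = 0)
  (hG' : constantCoeff (pderiv K 0 G) ≠ 0)

include hG hG'

theorem mk_X_one_dvd_mk {a : MvPowerSeries (Fin 3) K} (ha : constantCoeff a = 0) :
    Ideal.Quotient.mk (Ideal.span {X 2, G}) (X 1) ∣ Ideal.Quotient.mk (Ideal.span {X 2, G}) a := by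
  set π := Ideal.Quotient.mk (Ideal.span {X 2, G})
  have hX2 : π (X 2) = 0 := Ideal.Quotient.eq_zero_iff_mem.2 (Ideal.subset_span (by simp))
  have hπG : π G = 0 := Ideal.Quotient.eq_zero_iff_mem.2 (Ideal.subset_span (by simp))
  obtain ⟨g, hg⟩ := exists_eq_sum_X_mul hG
  obtain ⟨b, hb⟩ := exists_eq_sum_X_mul ha
  have hg0 : IsUnit (g 0) := by
    rw [isUnit_iff_constantCoeff, isUnit_iff_ne_zero]
    simpa [hg, Fin.sum_univ_three, Derivation.leibniz, pderiv_X_self, pderiv_X_of_ne] using hG'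
  have hX0 : π (X 1) ∣ π (X 0) := by
    rw [← (hg0.map π).dvd_mul_right, ← dvd_neg]
    refine ⟨π (g 1), ?_⟩
    have hsum := congrArg π hg
    simp only [hπG, Fin.sum_univ_three, map_add, map_mul, hX2] at hsum
    linear_combination hsum
  rw [hb, Fin.sum_univ_three]
  simp only [map_add, map_mul, hX2, zero_mul, add_zero]
  exact dvd_add (hX0.mul_right _) (dvd_mul_right _ _)

variable [CharZero K]

/- The derivation `∂₀G ∂₁ - ∂₁G ∂₀` preserves the ideal and lowers the exponent of `X 1`. -/
theorem X_one_pow_notMem_span (m : ℕ) : X 1 ^ m ∉ Ideal.span {X 2, G} := by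
  induction m with
  | zero =>
    intro h
    obtain ⟨a, b, hab⟩ := Ideal.mem_span_pair.1 h
    simpa [hG] using congrArg constantCoeff hab
  | succ k ih =>
    intro h
    obtain ⟨a, b, hab⟩ := Ideal.mem_span_pair.1 h
    have hunit : IsUnit (((k : MvPowerSeries (Fin 3) K) + 1) * pderiv K 0 G) := by
      rw [isUnit_iff_constantCoeff, isUnit_iff_ne_zero]
      simpa [hG'] using k.cast_add_one_ne_zero (R := K)
    refine ih ((Ideal.unit_mul_mem_iff_mem _ hunit).1 (Ideal.mem_span_pair.2
      ⟨pderiv K 0 G * pderiv K 1 a - pderiv K 1 G * pderiv K 0 a,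
        pderiv K 0 G * pderiv K 1 b - pderiv K 1 G * pderiv K 0 b, ?_⟩))
    have h0 := congrArg (pderiv K 0) hab
    have h1 := congrArg (pderiv K 1) hab
    simp only [map_add, Derivation.leibniz, Derivation.leibniz_pow, pderiv_X_self, pderiv_X_of_ne,
      ne_eq, Fin.reduceEq, not_false_eq_true, smul_eq_mul, nsmul_eq_mul, mul_zero, smul_zero,
      mul_one, Nat.add_sub_cancel, Nat.cast_add_one] at h0 h1
    linear_combination pderiv K 0 G * h1 - pderiv K 1 G * h0

theorem lt_of_isTypeAGerm {n m : ℕ} (hn : 2 ≤ n) (hm : 1 ≤ m) {U : MvPowerSeries (Fin 3) K}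
    (hU : IsUnit U) (h : IsTypeAGerm n (X 2 * G + X 1 ^ m * U)) : n < m := by
  by_contra! hmn
  set π := Ideal.Quotient.mk (Ideal.span {X 2, G})
  have hX2 : π (X 2) = 0 := Ideal.Quotient.eq_zero_iff_mem.2 (Ideal.subset_span (by simp))
  have hπG : π G = 0 := Ideal.Quotient.eq_zero_iff_mem.2 (Ideal.subset_span (by simp))
  have hm0 : m ≠ 0 := by lia
  have hd0 : pderiv K 0 (X 2 * G + X 1 ^ m * U) = X 2 * pderiv K 0 G + X 1 ^ m * pderiv K 0 U := by
    simp [Derivation.leibniz, Derivation.leibniz_pow, pderiv_X_of_ne]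
  have hd2 : pderiv K 2 (X 2 * G + X 1 ^ m * U) =
      X 2 * pderiv K 2 G + G + X 1 ^ m * pderiv K 2 U := by
    simp [Derivation.leibniz, Derivation.leibniz_pow, pderiv_X_self, pderiv_X_of_ne]
  have hd00 : pderiv K 0 (pderiv K 0 (X 2 * G + X 1 ^ m * U)) ∈ IsLocalRing.maximalIdeal _ := by
    rw [hd0, mem_maximalIdeal_iff_constantCoeff]
    simp [Derivation.leibniz, Derivation.leibniz_pow, pderiv_X_of_ne, hm0]
  have hd02 : pderiv K 0 (pderiv K 2 (X 2 * G + X 1 ^ m * U)) ∉ IsLocalRing.maximalIdeal _ := by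
    rw [hd2, mem_maximalIdeal_iff_constantCoeff]
    simpa [Derivation.leibniz, Derivation.leibniz_pow, pderiv_X_of_ne, hm0] using hG'
  obtain ⟨r, hr⟩ := h.pow_succ_dvd hn hm hmn hd00 hd02 (π := π) (x := π (X 1))
    (fun a ha => mk_X_one_dvd_mk hG hG' (mem_maximalIdeal_iff_constantCoeff.1 ha))
    (by simp [hX2]) (by simp [hd0, hX2]) (by simp [hd2, hX2, hπG])
  obtain ⟨r, rfl⟩ := Ideal.Quotient.mk_surjective r
  have hunit : IsUnit (U - X 1 * r) := by
    rw [isUnit_iff_constantCoeff]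
    simpa using isUnit_constantCoeff U hU
  refine X_one_pow_notMem_span hG hG' m (((Ideal.unit_mul_mem_iff_mem _ hunit).1) ?_)
  rw [← Ideal.Quotient.eq_zero_iff_mem]
  simp only [map_add, map_mul, map_sub, map_pow, hX2, zero_mul, zero_add] at hr ⊢
  linear_combination hr

end PowerSeries

open MvPolynomial

section DirectionalDerivative

variable {σ R A : Type*} [CommSemiring R]

theorem aeval_smul_of_isHomogeneous [CommSemiring A] [Algebra R A] {f : MvPolynomial σ R} {n : ℕ}
    (hf : f.IsHomogeneous n) (c : A) (w : σ → A) : aeval (c • w) f = c ^ n * aeval w f := by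
  simp only [aeval_def, eval₂_eq, Finset.mul_sum]
  refine Finset.sum_congr rfl fun m hm => ?_
  have hdeg : ∑ i ∈ m.support, m i = n := (hf.degree_eq_sum_deg_support hm).symm
  simp only [Pi.smul_apply, smul_eq_mul, mul_pow, Finset.prod_mul_distrib,
    Finset.prod_pow_eq_pow_sum, hdeg]
  ring

theorem eval_smul_of_isHomogeneous {f : MvPolynomial σ R} {n : ℕ} (hf : f.IsHomogeneous n)
    (c : R) (w : σ → R) : eval (c • w) f = c ^ n * eval w f :=
  aeval_smul_of_isHomogeneous hf c w

theorem derivation_aeval [Fintype σ] [CommSemiring A] [Algebra R A] (D : Derivation R A A)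
    (w : σ → A) (f : MvPolynomial σ R) :
    D (aeval w f) = ∑ i, D (w i) * aeval w (pderiv i f) := by
  classical
  induction f using MvPolynomial.induction_on with
  | C a => simp
  | add p q hp hq => simp [hp, hq, mul_add, Finset.sum_add_distrib]
  | mul_X p j hp =>
    simp [hp, pderiv_X, Pi.single_apply, mul_add, Finset.sum_add_distrib, Finset.mul_sum,
      apply_ite (aeval w), mul_comm, mul_left_comm, add_comm]

/-- The derivation `∑ᵢ vᵢ ∂ᵢ` of the polynomial ring: differentiation in the direction of the
constant vector `v`. -/
def dirDeriv (v : σ → R) : Derivation R (MvPolynomial σ R) (MvPolynomial σ R) :=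
  mkDerivation R fun i => C (v i)

@[simp]
theorem dirDeriv_X (v : σ → R) (i : σ) : dirDeriv v (X i) = C (v i) :=
  mkDerivation_X _ _ _

theorem pderiv_eq_dirDeriv [DecidableEq σ] (i : σ) :
    pderiv i = dirDeriv (Pi.single i (1 : R)) :=
  derivation_ext fun j => by
    simp [pderiv_X, Pi.single_apply, apply_ite C]

theorem dirDeriv_apply [Fintype σ] (v : σ → R) (f : MvPolynomial σ R) :
    dirDeriv v f = ∑ i, C (v i) * pderiv i f := by
  simpa using derivation_aeval (dirDeriv v) X f

theorem aeval_dirDeriv [Fintype σ] [CommSemiring A] [Algebra R A] (f : MvPolynomial σ R)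
    (v : σ → R) (w : σ → A) :
    aeval w (dirDeriv v f) = ∑ i, algebraMap R A (v i) * aeval w (pderiv i f) := by
  simp [dirDeriv_apply]

theorem eval_dirDeriv [Fintype σ] (f : MvPolynomial σ R) (v w : σ → R) :
    eval w (dirDeriv v f) = ∑ i, v i * eval w (pderiv i f) := by
  simp [dirDeriv_apply]

theorem isHomogeneous_dirDeriv [Finite σ] {f : MvPolynomial σ R} {n : ℕ} (hf : f.IsHomogeneous n)
    (v : σ → R) : (dirDeriv v f).IsHomogeneous (n - 1) := by
  cases nonempty_fintype σ
  rw [dirDeriv_apply]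
  exact IsHomogeneous.sum _ _ _ fun _ _ => hf.pderiv.C_mul _

theorem eval_dirDeriv_self [Finite σ] {f : MvPolynomial σ R} {n : ℕ} (hf : f.IsHomogeneous n)
    (w : σ → R) : eval w (dirDeriv w f) = n * eval w f := by
  cases nonempty_fintype σ
  rw [eval_dirDeriv]
  simpa using congrArg (eval w) hf.sum_X_mul_pderiv

end DirectionalDerivative

section LineRestrict

/-- The restriction `f(v + T p)` of `f` to the line through `v` in the direction `p`, as a
polynomial in the parameter `T`. -/
def lineRestrict {σ R : Type*} [CommSemiring R] (f : MvPolynomial σ R) (v p : σ → R) :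
    Polynomial R :=
  aeval (fun i => Polynomial.C (v i) + Polynomial.X * Polynomial.C (p i)) f

theorem eval_lineRestrict {σ R : Type*} [CommSemiring R] (f : MvPolynomial σ R) (v p : σ → R)
    (c : R) : (lineRestrict f v p).eval c = eval (v + c • p) f := by
  rw [lineRestrict, ← Polynomial.coe_aeval_eq_eval, ← AlgHom.comp_apply, comp_aeval,
    aeval_eq_eval]
  congr 2
  funext i
  simp [mul_comm c]

theorem derivative_lineRestrict {σ R : Type*} [Finite σ] [CommSemiring R] (f : MvPolynomial σ R)
    (v p : σ → R) :
    Polynomial.derivative (lineRestrict f v p) = lineRestrict (dirDeriv p f) v p := by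
  cases nonempty_fintype σ
  have hchain := derivation_aeval (Polynomial.derivative' (R := R))
    (fun i => Polynomial.C (v i) + Polynomial.X * Polynomial.C (p i)) f
  rw [lineRestrict, lineRestrict, aeval_dirDeriv]
  simpa using hchain

theorem natDegree_lineRestrict_le {σ R : Type*} [CommSemiring R] {f : MvPolynomial σ R} {n : ℕ}
    (hf : f.IsHomogeneous n) (v p : σ → R) : (lineRestrict f v p).natDegree ≤ n := by
  refine (aeval_natDegree_le f hf.totalDegree_le _ fun i => ?_).trans_eq (mul_one n)
  rw [add_comm, Polynomial.X_mul_C]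
  exact Polynomial.natDegree_linear_le

variable {σ K : Type*} [Field K] [Infinite K]

theorem reflect_lineRestrict {f : MvPolynomial σ K} {n : ℕ} (hf : f.IsHomogeneous n)
    (v p : σ → K) : (lineRestrict f v p).reflect n = lineRestrict f p v := by
  refine Polynomial.eq_of_infinite_eval_eq _ _ ((Set.finite_singleton 0).infinite_compl.mono ?_)
  intro c hc
  have hc0 : c ≠ 0 := hc
  have hline : p + c • v = c • (v + c⁻¹ • p) := by
    rw [smul_add, smul_inv_smul₀ hc0, add_comm]
  let _ : Invertible c⁻¹ := invertibleOfNonzero (inv_ne_zero hc0)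
  have hreflect := Polynomial.eval₂_reflect_mul_pow (RingHom.id K) c⁻¹ n (lineRestrict f v p)
    (natDegree_lineRestrict_le hf v p)
  rw [invOf_eq_inv, inv_inv, ← Polynomial.eval, ← Polynomial.eval, eval_lineRestrict] at hreflect
  change Polynomial.eval c _ = Polynomial.eval c _
  rw [eval_lineRestrict, hline, eval_smul_of_isHomogeneous hf, ← hreflect, mul_left_comm,
    ← mul_pow, mul_inv_cancel₀ hc0, one_pow, mul_one]

theorem coeff_lineRestrict {f : MvPolynomial σ K} {n : ℕ} (hf : f.IsHomogeneous n)
    (v p : σ → K) : (lineRestrict f v p).coeff n = eval p f := by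
  have hcoeff := congrArg (Polynomial.coeff · 0) (reflect_lineRestrict hf v p)
  rw [Polynomial.coeff_reflect, Polynomial.revAt_zero, Polynomial.coeff_zero_eq_eval_zero,
    eval_lineRestrict, zero_smul, add_zero] at hcoeff
  exact hcoeff

theorem lineRestrict_ne_zero {f : MvPolynomial σ K} {n : ℕ} (hf : f.IsHomogeneous n)
    {p : σ → K} (hp : eval p f ≠ 0) (v : σ → K) : lineRestrict f v p ≠ 0 := fun h => hp <| by
  rw [← coeff_lineRestrict hf v p, h, Polynomial.coeff_zero]

end LineRestrict

section Irreducible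

theorem mul_eq_mul_homogeneousComponent_totalDegree {σ R : Type*} [CommRing R] [IsDomain R]
    {a b : MvPolynomial σ R} {n : ℕ} (h : (a * b).IsHomogeneous n) (h0 : a * b ≠ 0) :
    a * b = homogeneousComponent a.totalDegree a * homogeneousComponent b.totalDegree b := by
  have hn : n = a.totalDegree + b.totalDegree := by
    rw [← h.totalDegree h0, totalDegree_mul_of_isDomain (left_ne_zero_of_mul h0)
      (right_ne_zero_of_mul h0)]
  have hterm (i j : ℕ) :
      homogeneousComponent n (homogeneousComponent i a * homogeneousComponent j b) =
        if n = i + j then homogeneousComponent i a * homogeneousComponent j b else 0 :=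
    homogeneousComponent_of_mem ((mem_homogeneousSubmodule _ _).2
      ((homogeneousComponent_isHomogeneous i a).mul (homogeneousComponent_isHomogeneous j b)))
  have hself : homogeneousComponent n (a * b) = a * b := by
    rw [homogeneousComponent_of_mem ((mem_homogeneousSubmodule n _).2 h), if_pos rfl]
  conv_lhs => rw [← hself, ← sum_homogeneousComponent a, ← sum_homogeneousComponent b]
  simp only [Finset.sum_mul_sum, map_sum, hterm]
  rw [Finset.sum_eq_single a.totalDegree, Finset.sum_eq_single b.totalDegree, if_pos hn]
  · intro j hj hj'
    rw [if_neg (by rw [Finset.mem_range] at hj; omega)]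
  · simp
  · intro i hi hi'
    refine Finset.sum_eq_zero fun j hj => ?_
    rw [if_neg (by rw [Finset.mem_range] at hi hj; omega)]
  · simp

theorem isUnit_of_totalDegree_eq_zero {σ K : Type*} [Field K] {g : MvPolynomial σ K} (hg : g ≠ 0)
    (hdeg : g.totalDegree = 0) : IsUnit g := by
  obtain ⟨c, rfl⟩ : ∃ c, g = C c := ⟨_, totalDegree_eq_zero_iff_eq_C.1 hdeg⟩
  exact (isUnit_iff_ne_zero.2 (by simpa using hg)).map C

variable {σ K : Type*} [Field K] [Infinite K]

theorem eval_eq_zero_of_mul_invariant {a b : MvPolynomial σ K} {n : ℕ} (ha : a.IsHomogeneous n)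
    (hn : n ≠ 0) {p v : σ → K} (hinv : ∀ c : K, eval (v + c • p) (a * b) = eval v (a * b))
    (hv : eval v (a * b) ≠ 0) : eval p a = 0 := by
  have hconst : lineRestrict a v p * lineRestrict b v p = Polynomial.C (eval v (a * b)) := by
    refine Polynomial.funext fun c => ?_
    rw [Polynomial.eval_mul, eval_lineRestrict, eval_lineRestrict, Polynomial.eval_C, ← hinv c,
      map_mul]
  have hunit : IsUnit (lineRestrict a v p) :=
    isUnit_of_mul_isUnit_left (hconst ▸ Polynomial.isUnit_C.2 (isUnit_iff_ne_zero.2 hv))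
  rw [← coeff_lineRestrict ha v p]
  exact Polynomial.coeff_eq_zero_of_natDegree_lt
    (by rw [Polynomial.natDegree_eq_zero_of_isUnit hunit]; omega)

/- Both factors of a proper factorization are constant along the line through `v`, so both vanish at
its point at infinity `p`, which is then singular. -/
theorem irreducible_of_smooth_of_invariant {f : MvPolynomial σ K} {d : ℕ} (hf : f.IsHomogeneous d)
    {p v e : σ → K} (hp : eval p f = 0) (he : eval p (dirDeriv e f) ≠ 0)
    (hinv : ∀ c : K, eval (v + c • p) f = eval v f) (hv : eval v f ≠ 0) : Irreducible f := by
  have hf0 : f ≠ 0 := by rintro rfl; simp at hv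
  refine ⟨fun hu => (hu.map (eval p)).ne_zero hp, fun {a b} hab => ?_⟩
  have hfactor := mul_eq_mul_homogeneousComponent_totalDegree (hab ▸ hf) (hab ▸ hf0)
  rw [← hab] at hfactor
  set A := homogeneousComponent a.totalDegree a
  set B := homogeneousComponent b.totalDegree b
  by_contra! hnonunit
  have ha : a.totalDegree ≠ 0 := fun h =>
    hnonunit.1 (isUnit_of_totalDegree_eq_zero (left_ne_zero_of_mul (hab ▸ hf0)) h)
  have hb : b.totalDegree ≠ 0 := fun h =>
    hnonunit.2 (isUnit_of_totalDegree_eq_zero (right_ne_zero_of_mul (hab ▸ hf0)) h)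
  have hA : eval p A = 0 := eval_eq_zero_of_mul_invariant
    (homogeneousComponent_isHomogeneous _ a) ha (hfactor ▸ hinv) (hfactor ▸ hv)
  have hB : eval p B = 0 := eval_eq_zero_of_mul_invariant
    (homogeneousComponent_isHomogeneous _ b) hb (mul_comm A B ▸ hfactor ▸ hinv)
    (mul_comm A B ▸ hfactor ▸ hv)
  exact he (by simp [hfactor, Derivation.leibniz, hA, hB])

end Irreducible

section Lines

variable {f g : MvPolynomial (Fin 4) ℂ} {d n : ℕ} {L : Submodule ℂ V4} {P Q : P3}

theorem liesOn_iff : LiesOn Q L ↔ Q.rep ∈ L := by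
  rw [LiesOn, Projectivization.submodule_eq, Submodule.span_singleton_le_iff_mem]

theorem mem_tangentSpaceAt {v : V4} : v ∈ tangentSpaceAt f P ↔ eval P.rep (dirDeriv v f) = 0 := by
  simp [tangentSpaceAt, LinearMap.mem_ker, eval_dirDeriv, LinearMap.sum_apply, mul_comm]

theorem isSingularPoint_iff :
    IsSingularPoint f Q ↔ eval Q.rep f = 0 ∧ ∀ v, eval Q.rep (dirDeriv v f) = 0 := by
  refine and_congr_right fun _ => ⟨fun h v => ?_, fun h i => ?_⟩
  · simp [eval_dirDeriv, h]
  · rw [pderiv_eq_dirDeriv]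
    exact h _

theorem IsSmoothPoint.not_isSingularPoint (hP : IsSmoothPoint f P) : ¬ IsSingularPoint f P :=
  fun h => hP.2.elim fun i hi => hi (h.2 i)

theorem span_pair_eq_of_finrank_eq_two {K V : Type*} [Field K] [AddCommGroup V] [Module K V]
    {L : Submodule K V} (hL : Module.finrank K L = 2) {p e : V} (hp : p ∈ L) (he : e ∈ L)
    (hpe : LinearIndependent K ![p, e]) : Submodule.span K {p, e} = L := by
  have : FiniteDimensional K L := .of_finrank_pos (by omega)
  refine Submodule.eq_of_le_of_finrank_eq (Submodule.span_le.2 (Set.pair_subset hp he)) ?_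
  rw [← Matrix.range_cons_cons_empty, finrank_span_eq_card hpe, hL, Fintype.card_fin]

theorem exists_span_pair_eq {K V : Type*} [Field K] [AddCommGroup V] [Module K V]
    {L : Submodule K V} (hL : Module.finrank K L = 2) {p : V} (hp : p ∈ L) (hp0 : p ≠ 0) :
    ∃ e, Submodule.span K {p, e} = L := by
  obtain ⟨e, he⟩ := exists_linearIndependent_pair_of_one_lt_finrank (R := K) (M := L)
    (by omega) (x := ⟨p, hp⟩) (by simpa using hp0)
  refine ⟨e, span_pair_eq_of_finrank_eq_two hL hp e.2 ?_⟩
  rw [LinearIndependent.pair_iff] at he ⊢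
  simpa [Subtype.ext_iff] using he

theorem linearIndependent_rep_pair (hPQ : P ≠ Q) : LinearIndependent ℂ ![P.rep, Q.rep] := by
  have hindep := Projectivization.independent_iff.1
    ((Projectivization.independent_pair_iff_ne P Q).2 hPQ)
  rwa [show Projectivization.rep ∘ ![P, Q] = ![P.rep, Q.rep] by
    ext i; fin_cases i <;> rfl] at hindep

/-- The points of the line `L` at which the form `g` vanishes. -/
def zerosOn (g : MvPolynomial (Fin 4) ℂ) (L : Submodule ℂ V4) : Set P3 :=
  {Q | LiesOn Q L ∧ eval Q.rep g = 0}

/-- The points of the line `L` that are singular points of the surface `f = 0`. -/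
def singularPointsOn (f : MvPolynomial (Fin 4) ℂ) (L : Submodule ℂ V4) : Set P3 :=
  {Q | LiesOn Q L ∧ IsSingularPoint f Q}

theorem exists_isRoot_lineRestrict (hg : g.IsHomogeneous n) {p e : V4} (hp : eval p g ≠ 0)
    (hQ : Q ∈ zerosOn g (Submodule.span ℂ {p, e})) :
    ∃ b t : ℂ, b ≠ 0 ∧ Q.rep = b • (e + t • p) ∧ (lineRestrict g e p).IsRoot t := by
  obtain ⟨hQL, hQg⟩ := hQ
  obtain ⟨a, b, hab⟩ := Submodule.mem_span_pair.1 (liesOn_iff.1 hQL)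
  have hb : b ≠ 0 := by
    rintro rfl
    rw [zero_smul, add_zero] at hab
    rw [← hab, eval_smul_of_isHomogeneous hg] at hQg
    have ha : a = 0 := eq_zero_of_pow_eq_zero ((mul_eq_zero.1 hQg).resolve_right hp)
    exact Q.rep_nonzero (by rw [← hab, ha, zero_smul])
  have hrep : Q.rep = b • (e + (a / b) • p) := by
    rw [← hab, smul_add, smul_smul, mul_div_cancel₀ _ hb, add_comm]
  refine ⟨b, a / b, hb, hrep, ?_⟩
  rw [hrep, eval_smul_of_isHomogeneous hg, ← eval_lineRestrict] at hQg
  exact (mul_eq_zero.1 hQg).resolve_left (pow_ne_zero n hb)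

theorem encard_zerosOn_le_card_roots (hg : g.IsHomogeneous n) {p : V4} (hp : eval p g ≠ 0)
    (e : V4) : (zerosOn g (Submodule.span ℂ {p, e})).encard ≤
      (lineRestrict g e p).roots.toFinset.card := by
  choose! b t hb hrep hroot using fun Q => exists_isRoot_lineRestrict (Q := Q) (e := e) hg hp
  rw [← Set.encard_coe_eq_coe_finsetCard]
  refine Set.encard_le_encard_of_injOn (f := t) (fun Q hQ => ?_) (fun Q hQ Q' hQ' htt => ?_)
  · simpa [lineRestrict_ne_zero hg hp] using hroot Q hQ
  · rw [← Q.mk_rep, ← Q'.mk_rep, Projectivization.mk_eq_mk_iff']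
    refine ⟨b Q * (b Q')⁻¹, ?_⟩
    rw [hrep Q hQ, hrep Q' hQ', htt, smul_smul, inv_mul_cancel_right₀ (hb Q' hQ')]

theorem encard_zerosOn_le (hg : g.IsHomogeneous n) (hL : Module.finrank ℂ L = 2) {p : V4}
    (hpL : p ∈ L) (hp : eval p g ≠ 0) (hp0 : p ≠ 0) : (zerosOn g L).encard ≤ n := by
  obtain ⟨e, rfl⟩ := exists_span_pair_eq hL hpL hp0
  refine (encard_zerosOn_le_card_roots hg hp e).trans ?_
  exact_mod_cast (Multiset.toFinset_card_le _).trans <|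
    (Polynomial.card_roots' _).trans (natDegree_lineRestrict_le hg e p)

theorem eval_eq_zero_of_lt_encard_zerosOn (hg : g.IsHomogeneous n) (hL : Module.finrank ℂ L = 2)
    (hcard : n < (zerosOn g L).encard) {v : V4} (hv : v ∈ L) : eval v g = 0 := by
  by_contra hne
  refine (encard_zerosOn_le hg hL hv hne ?_).not_gt hcard
  rintro rfl
  obtain ⟨Q, hQ⟩ := Set.encard_pos.1 (pos_of_gt hcard)
  rw [← zero_smul ℂ Q.rep, eval_smul_of_isHomogeneous hg, hQ.2, mul_zero] at hne
  exact hne rfl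

theorem not_isRoot_derivative_of_natDegree_le_card_roots {K : Type*} [Field K] [DecidableEq K]
    {r : Polynomial K} (hr : r ≠ 0) (hcard : r.natDegree ≤ r.roots.toFinset.card) {t : K}
    (ht : r.IsRoot t) : ¬ r.derivative.IsRoot t := by
  intro ht'
  have hnodup : r.roots.Nodup := Multiset.toFinset_card_eq_card_iff_nodup.1 <|
    (Multiset.toFinset_card_le _).antisymm ((Polynomial.card_roots' r).trans hcard)
  have hmult := (Polynomial.one_lt_rootMultiplicity_iff_isRoot hr).2 ⟨ht, ht'⟩
  rw [← Polynomial.count_roots] at hmult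
  exact hmult.not_ge (Multiset.nodup_iff_count_le_one.1 hnodup t)

theorem eval_dirDeriv_ne_zero_of_le_encard_zerosOn (hg : g.IsHomogeneous n)
    (hL : Module.finrank ℂ L = 2) (hPL : LiesOn P L) (hP : eval P.rep g ≠ 0)
    (hcard : n ≤ (zerosOn g L).encard) (hQ : Q ∈ zerosOn g L) :
    eval Q.rep (dirDeriv P.rep g) ≠ 0 := by
  obtain ⟨e, rfl⟩ := exists_span_pair_eq hL (liesOn_iff.1 hPL) P.rep_nonzero
  obtain ⟨b, t, hb, hrep, hroot⟩ := exists_isRoot_lineRestrict hg hP hQ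
  have hcard' : n ≤ (lineRestrict g e P.rep).roots.toFinset.card := by
    exact_mod_cast hcard.trans (encard_zerosOn_le_card_roots hg hP e)
  have hsimple := not_isRoot_derivative_of_natDegree_le_card_roots (lineRestrict_ne_zero hg hP e)
    ((natDegree_lineRestrict_le hg _ _).trans hcard') hroot
  rw [derivative_lineRestrict, Polynomial.IsRoot, eval_lineRestrict] at hsimple
  rw [hrep, eval_smul_of_isHomogeneous (isHomogeneous_dirDeriv hg _)]
  exact mul_ne_zero (pow_ne_zero _ hb) hsimple

theorem encard_singularPointsOn_le (hf : f.IsHomogeneous d) (hL : Module.finrank ℂ L = 2)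
    (hPL : LiesOn P L) (hP : IsSmoothPoint f P) :
    (singularPointsOn f L).encard ≤ (d - 1 : ℕ) := by
  obtain ⟨i, hi⟩ := hP.2
  have hsub : singularPointsOn f L ⊆ zerosOn (pderiv i f) L := fun Q hQ => ⟨hQ.1, hQ.2.2 i⟩
  exact (Set.encard_le_encard hsub).trans
    (encard_zerosOn_le hf.pderiv hL (liesOn_iff.1 hPL) hi P.rep_nonzero)

theorem eval_add_smul_of_dirDeriv_eq_zero {σ K : Type*} [Finite σ] [Field K] [CharZero K]
    {f : MvPolynomial σ K} {v p : σ → K} (h : ∀ c : K, eval (v + c • p) (dirDeriv p f) = 0)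
    (c : K) : eval (v + c • p) f = eval v f := by
  have hderiv : (lineRestrict f v p).derivative = 0 := by
    rw [derivative_lineRestrict]
    exact Polynomial.funext fun c => by rw [eval_lineRestrict, h, Polynomial.eval_zero]
  have hconst := Polynomial.eq_C_of_derivative_eq_zero hderiv
  have hzero : eval v f = (lineRestrict f v p).eval 0 := by simp [eval_lineRestrict]
  rw [← eval_lineRestrict, hzero, hconst, Polynomial.eval_C, Polynomial.eval_C]

theorem eval_eq_zero_of_le_encard_singularPointsOn (hd : 2 ≤ d) (hf : f.IsHomogeneous d)
    (hL : Module.finrank ℂ L = 2) (hPL : LiesOn P L) (hP : IsSmoothPoint f P)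
    (hcard : (d - 1 : ℕ) ≤ (singularPointsOn f L).encard) {v : V4} (hv : v ∈ L) :
    eval v f = 0 := by
  have hPS : P ∉ singularPointsOn f L := fun h => hP.not_isSingularPoint h.2
  have hsub : insert P (singularPointsOn f L) ⊆ zerosOn (dirDeriv P.rep f) L := by
    refine Set.insert_subset ⟨hPL, ?_⟩ fun Q hQ => ⟨hQ.1, (isSingularPoint_iff.1 hQ.2).2 _⟩
    rw [eval_dirDeriv_self hf, hP.1, mul_zero]
  have hlt : (d - 1 : ℕ) < (zerosOn (dirDeriv P.rep f) L).encard := by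
    refine lt_of_lt_of_le ?_ ((add_le_add_left hcard 1).trans
      ((Set.encard_insert_of_notMem hPS).symm.trans_le (Set.encard_le_encard hsub)))
    exact_mod_cast Nat.lt_succ_self _
  have hinv (w : V4) (hw : w ∈ L) (c : ℂ) : eval (w + c • P.rep) f = eval w f :=
    eval_add_smul_of_dirDeriv_eq_zero (fun c => eval_eq_zero_of_lt_encard_zerosOn
      (isHomogeneous_dirDeriv hf _) hL hlt
      (L.add_mem hw (L.smul_mem c (liesOn_iff.1 hPL)))) c
  obtain ⟨Q, hQL, hQ⟩ : (singularPointsOn f L).Nonempty := by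
    refine Set.encard_pos.1 (lt_of_lt_of_le ?_ hcard)
    exact_mod_cast (by omega : 0 < d - 1)
  have hPQ : P ≠ Q := by rintro rfl; exact hP.not_isSingularPoint hQ
  rw [← span_pair_eq_of_finrank_eq_two hL (liesOn_iff.1 hPL) (liesOn_iff.1 hQL)
    (linearIndependent_rep_pair hPQ)] at hv
  obtain ⟨x, y, rfl⟩ := Submodule.mem_span_pair.1 hv
  rw [add_comm, hinv _ (L.smul_mem y (liesOn_iff.1 hQL)), eval_smul_of_isHomogeneous hf, hQ.1,
    mul_zero]

theorem le_tangentSpaceAt_of_eval_eq_zero (hPL : LiesOn P L) (hf : ∀ v ∈ L, eval v f = 0) :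
    L ≤ tangentSpaceAt f P := fun v hv => by
  have hzero : lineRestrict f P.rep v = 0 := Polynomial.funext fun c => by
    rw [eval_lineRestrict, Polynomial.eval_zero]
    exact hf _ (L.add_mem (liesOn_iff.1 hPL) (L.smul_mem c hv))
  have hderiv := derivative_lineRestrict f P.rep v
  rw [hzero, Polynomial.derivative_zero] at hderiv
  simpa [mem_tangentSpaceAt, eval_lineRestrict] using congrArg (Polynomial.eval 0) hderiv.symm

end Lines

section LocalEquation

theorem X_dvd_of_eval_eq_zero {σ K : Type*} [Field K] [Infinite K] {p : MvPolynomial σ K} {i : σ}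
    (h : ∀ x : σ → K, x i = 0 → eval x p = 0) : X i ∣ p := by
  classical
  let π := Ideal.Quotient.mkₐ K (Ideal.span {(X i : MvPolynomial σ K)})
  have hsubst : aeval (Function.update X i (0 : MvPolynomial σ K)) p = 0 := by
    refine MvPolynomial.funext fun x => ?_
    rw [map_zero, ← h (Function.update x i 0) (Function.update_self ..), ← aeval_eq_eval,
      ← aeval_eq_eval, comp_aeval_apply]
    congr 2
    funext j
    rcases eq_or_ne j i with rfl | hj <;> simp [*]
  have hπ : π.comp (aeval (Function.update X i 0)) = π := by
    refine algHom_ext fun j => ?_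
    rcases eq_or_ne j i with rfl | hj
    · simp [π]
    · simp [hj]
  have hp : π p = 0 := by rw [← hπ, AlgHom.comp_apply, hsubst, map_zero]
  exact Ideal.mem_span_singleton.1 (Ideal.Quotient.eq_zero_iff_mem.1 hp)

theorem exists_eq_X_two_mul_add_aeval_X_one {K : Type*} [Field K] [Infinite K]
    {F : MvPolynomial (Fin 3) K} {H : Polynomial K}
    (h : ∀ x y : K, eval ![x, y, 0] F = H.eval y) :
    ∃ G, F = X 2 * G + Polynomial.aeval (X 1) H ∧ constantCoeff (pderiv 2 F) = constantCoeff G ∧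
      constantCoeff (pderiv 0 (pderiv 2 F)) = constantCoeff (pderiv 0 G) := by
  obtain ⟨G, hG⟩ : X 2 ∣ F - Polynomial.aeval (X 1) H := X_dvd_of_eval_eq_zero fun x hx => by
    have hvec : x = ![x 0, x 1, 0] := by
      funext i
      fin_cases i <;> simp [hx]
    rw [map_sub, ← aeval_eq_eval x, ← Polynomial.aeval_algHom_apply, aeval_X,
      Polynomial.coe_aeval_eq_eval, aeval_eq_eval]
    nth_rewrite 1 [hvec]
    rw [h, sub_self]
  have hF : F = X 2 * G + Polynomial.aeval (X 1) H := by rw [← hG, sub_add_cancel]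
  have hF2 : pderiv 2 F = X 2 * pderiv 2 G + G := by
    simp [hF, Derivation.leibniz, Derivation.map_aeval]
  exact ⟨G, hF, by simp [hF2], by simp [hF2, Derivation.leibniz]⟩

/-- The point `p + x₀ v₀ + x₁ v₁ + x₂ v₂` of the affine chart of `ℂ⁴` with origin `p` and directions
`v`, for coordinates `x` in a `ℂ`-algebra. -/
def chartPoint {A : Type*} [CommRing A] [Algebra ℂ A] (p : V4) (v : Fin 3 → V4) (x : Fin 3 → A) :
    Fin 4 → A :=
  fun i => algebraMap ℂ A (p i) + ∑ j, algebraMap ℂ A (v j i) * x j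

variable {f : MvPolynomial (Fin 4) ℂ} {Q : P3} {v : Fin 3 → V4}

theorem aeval_localEquation {A : Type*} [CommRing A] [Algebra ℂ A] (x : Fin 3 → A) :
    aeval x (localEquation f Q v) = aeval (chartPoint Q.rep v x) f := by
  rw [localEquation, aeval_bind₁]
  congr 2
  funext i
  simp [chartPoint]

theorem eval_localEquation (x : Fin 3 → ℂ) :
    eval x (localEquation f Q v) = eval (Q.rep + ∑ j, x j • v j) f := by
  refine (aeval_localEquation x).trans ?_
  rw [aeval_eq_eval]
  congr 2
  funext i
  simp [chartPoint, mul_comm]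

theorem constantCoeff_localEquation : constantCoeff (localEquation f Q v) = eval Q.rep f := by
  simp [← eval_zero, eval_localEquation]

theorem pderiv_localEquation (j : Fin 3) :
    pderiv j (localEquation f Q v) = localEquation (dirDeriv (v j) f) Q v := by
  have heq (g : MvPolynomial (Fin 4) ℂ) :
      localEquation g Q v = aeval (chartPoint Q.rep v X) g := rfl
  rw [heq, heq, derivation_aeval, aeval_dirDeriv]
  refine Finset.sum_congr rfl fun i _ => ?_
  congr 1
  simp [chartPoint, algebraMap_eq, pderiv_X, Pi.single_apply]

theorem coe_localEquation : (localEquation f Q v : MvPowerSeries (Fin 3) ℂ) =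
    aeval (chartPoint Q.rep v MvPowerSeries.X) f := by
  have hcoe := aeval_unique (coeToMvPowerSeries.algHom (σ := Fin 3) (R := ℂ) ℂ)
  rw [← aeval_localEquation]
  simpa [Function.comp_def, Algebra.algebraMap_self] using
    DFunLike.congr_fun hcoe (localEquation f Q v)

theorem exists_eq_smul_add_sum_of_linearIndependent {p : V4} {v : Fin 3 → V4}
    (hv : LinearIndependent ℂ (Fin.cons p v : Fin 4 → V4)) :
    ∃ (ℓ : V4 →ₗ[ℂ] ℂ) (κ : Fin 3 → V4 →ₗ[ℂ] ℂ), ∀ e, e = ℓ e • p + ∑ j, κ j e • v j := by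
  let b := basisOfLinearIndependentOfCardEqFinrank hv (by simp)
  have hb (i : Fin 4) : b i = (Fin.cons p v : Fin 4 → V4) i := by simp [b]
  refine ⟨b.coord 0, fun j => b.coord j.succ, fun e => ?_⟩
  conv_lhs => rw [← b.sum_repr e, Fin.sum_univ_succ]
  simp [hb]

/- Writing `v` in the basis `p, v₀` expresses the point of the chart `v` as `s p + ∑ₖ aₖ v₀ₖ`, where
`s` is a unit and the `aₖ` have no constant term. -/
theorem exists_chartPoint_X_eq_smul {p : V4} {v₀ : Fin 3 → V4}
    (hv₀ : LinearIndependent ℂ (Fin.cons p v₀ : Fin 4 → V4)) (v : Fin 3 → V4) :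
    ∃ (s : MvPowerSeries (Fin 3) ℂ) (γ : Fin 3 → MvPowerSeries (Fin 3) ℂ), IsUnit s ∧
      (∀ k, MvPowerSeries.constantCoeff (γ k) = 0) ∧
      chartPoint p v MvPowerSeries.X = s • chartPoint p v₀ γ := by
  obtain ⟨ℓ, κ, hbasis⟩ := exists_eq_smul_add_sum_of_linearIndependent hv₀
  let s : MvPowerSeries (Fin 3) ℂ := 1 + ∑ j, MvPowerSeries.C (ℓ (v j)) * MvPowerSeries.X j
  let a (k : Fin 3) : MvPowerSeries (Fin 3) ℂ :=
    ∑ j, MvPowerSeries.C (κ k (v j)) * MvPowerSeries.X j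
  have hs : MvPowerSeries.constantCoeff s ≠ 0 := by simp [s]
  obtain ⟨γ, hγ, hsγ⟩ : ∃ γ : Fin 3 → MvPowerSeries (Fin 3) ℂ,
      (∀ k, MvPowerSeries.constantCoeff (γ k) = 0) ∧ ∀ k, s * γ k = a k :=
    ⟨fun k => s⁻¹ * a k, fun k => by simp [a], fun k => by
      rw [← mul_assoc, MvPowerSeries.mul_inv_cancel _ hs, one_mul]⟩
  refine ⟨s, γ, MvPowerSeries.isUnit_iff_constantCoeff.2 (isUnit_iff_ne_zero.2 hs), hγ, ?_⟩
  funext i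
  have hvi (j : Fin 3) : v j i = ℓ (v j) * p i + ∑ k, κ k (v j) * v₀ k i := by
    simpa using congrFun (hbasis (v j)) i
  simp only [a, Fin.sum_univ_three] at hsγ
  simp only [chartPoint, Pi.smul_apply, smul_eq_mul, MvPowerSeries.algebraMap_apply,
    Algebra.algebraMap_self_apply, hvi, Fin.sum_univ_three, map_add, map_mul]
  have hs : s = 1 + ∑ j, MvPowerSeries.C (ℓ (v j)) * MvPowerSeries.X j := rfl
  rw [Fin.sum_univ_three] at hs
  linear_combination -MvPowerSeries.C (p i) * hs - MvPowerSeries.C (v₀ 0 i) * hsγ 0 -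
    MvPowerSeries.C (v₀ 1 i) * hsγ 1 - MvPowerSeries.C (v₀ 2 i) * hsγ 2

theorem isLocalHom_substAlgHom {σ τ K : Type*} [Finite σ] [Field K]
    {γ : σ → MvPowerSeries τ K} (hγ : ∀ i, MvPowerSeries.constantCoeff (γ i) = 0) :
    IsLocalHom (MvPowerSeries.substAlgHom (R := K)
      (MvPowerSeries.hasSubst_of_constantCoeff_zero hγ)).toRingHom := by
  refine ⟨fun φ hφ => ?_⟩
  by_contra hunit
  have hφ0 : MvPowerSeries.constantCoeff φ = 0 := mem_maximalIdeal_iff_constantCoeff.1 hunit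
  refine mem_maximalIdeal_iff_constantCoeff.2 ?_ hφ
  simpa using MvPowerSeries.constantCoeff_subst_eq_zero
    (MvPowerSeries.hasSubst_of_constantCoeff_zero hγ) hγ hφ0

variable {d n : ℕ}

theorem IsTypeA.isTypeAGerm_localEquation (h : IsTypeA n f Q) (hf : f.IsHomogeneous d)
    (v : Fin 3 → V4) : IsTypeAGerm n (localEquation f Q v : MvPowerSeries (Fin 3) ℂ) := by
  obtain ⟨v₀, hv₀, z, u, hz, hu, h⟩ := h
  have hgerm : IsTypeAGerm n (localEquation f Q v₀ : MvPowerSeries (Fin 3) ℂ) :=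
    ⟨z, u, fun i => mem_maximalIdeal_iff_constantCoeff.2 (hz.1 i), hu, h⟩
  obtain ⟨s, γ, hs, hγ, hchart⟩ := exists_chartPoint_X_eq_smul hv₀ v
  have hlocal := isLocalHom_substAlgHom hγ
  have hsubst : MvPowerSeries.substAlgHom (MvPowerSeries.hasSubst_of_constantCoeff_zero hγ)
      (localEquation f Q v₀ : MvPowerSeries (Fin 3) ℂ) = aeval (chartPoint Q.rep v₀ γ) f := by
    rw [MvPowerSeries.substAlgHom_coe, aeval_localEquation]
  rw [coe_localEquation, hchart, aeval_smul_of_isHomogeneous hf, ← hsubst]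
  exact (hgerm.map (MvPowerSeries.substAlgHom
    (MvPowerSeries.hasSubst_of_constantCoeff_zero hγ)).toRingHom).isUnit_mul (hs.pow d)

theorem IsTypeA.isSingularPoint (h : IsTypeA n f Q) (hf : f.IsHomogeneous d) (hn : 1 ≤ n) :
    IsSingularPoint f Q := by
  refine isSingularPoint_iff.2 ⟨?_, fun e => ?_⟩
  · rw [← constantCoeff_localEquation (v := 0)]
    exact mem_maximalIdeal_iff_constantCoeff.1 (h.isTypeAGerm_localEquation hf 0).mem_maximalIdeal
  · have hderiv := mem_maximalIdeal_iff_constantCoeff.1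
      ((h.isTypeAGerm_localEquation hf fun _ => e).derivation_mem_maximalIdeal hn
        (MvPowerSeries.pderiv ℂ 0))
    rw [MvPowerSeries.pderiv_coe, pderiv_localEquation] at hderiv
    rw [← constantCoeff_localEquation (v := fun _ => e)]
    exact hderiv

/- The quadratic form `X₂ w` is diagonalized by `(X₂ + w) / 2` and `i (X₂ - w) / 2`. -/
theorem exists_isFormalCoordinates_sq_add_sq_eq {w : MvPowerSeries (Fin 3) ℂ}
    (hw : MvPowerSeries.constantCoeff w = 0)
    (hw' : MvPowerSeries.constantCoeff (MvPowerSeries.pderiv ℂ 0 w) ≠ 0) :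
    ∃ z, IsFormalCoordinates z ∧ z 0 ^ 2 + z 1 ^ 2 = MvPowerSeries.X 2 * w ∧
      z 2 = MvPowerSeries.X 1 := by
  have hcoeff : MvPowerSeries.coeff (Finsupp.single 0 1) w ≠ 0 := by
    rwa [← MvPowerSeries.coeff_zero_eq_constantCoeff_apply, MvPowerSeries.coeff_pderiv, zero_add,
      Finsupp.zero_apply, Nat.cast_zero, zero_add, mul_one] at hw'
  refine ⟨![MvPowerSeries.C (1 / 2) * (MvPowerSeries.X 2 + w),
    MvPowerSeries.C (Complex.I / 2) * (MvPowerSeries.X 2 - w), MvPowerSeries.X 1],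
    ⟨fun i => ?_, ?_⟩, ?_, rfl⟩
  · fin_cases i <;> simp [hw]
  · rw [Matrix.det_fin_three]
    simp only [Matrix.of_apply, Matrix.cons_val_zero, Matrix.cons_val_one, Matrix.cons_val,
      MvPowerSeries.coeff_C_mul, map_add, map_sub, MvPowerSeries.coeff_X,
      Finsupp.single_left_inj one_ne_zero, Fin.reduceEq, if_true, if_false]
    have hdet : Complex.I * MvPowerSeries.coeff (Finsupp.single 0 1) w ≠ 0 :=
      mul_ne_zero Complex.I_ne_zero hcoeff
    contrapose! hdet
    linear_combination (-2) * hdet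
  · have hI : (MvPowerSeries.C (Complex.I / 2) : MvPowerSeries (Fin 3) ℂ) ^ 2 =
        -MvPowerSeries.C (1 / 2) ^ 2 := by
      rw [← map_pow, ← map_pow, ← map_neg, div_pow, div_pow, Complex.I_sq, one_pow, neg_div]
    have h4 : (4 : MvPowerSeries (Fin 3) ℂ) * MvPowerSeries.C (1 / 2) ^ 2 = 1 := by
      rw [← map_pow, ← map_ofNat MvPowerSeries.C, ← map_mul, ← map_one MvPowerSeries.C]
      norm_num
    simp only [Matrix.cons_val_zero, Matrix.cons_val_one]
    linear_combination (MvPowerSeries.X 2 - w) ^ 2 * hI + MvPowerSeries.X 2 * w * h4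

theorem isTypeA_of_localEquation_eq {G U : MvPolynomial (Fin 3) ℂ}
    (hv : LinearIndependent ℂ (Fin.cons Q.rep v : Fin 4 → V4))
    (h : localEquation f Q v = X 2 * G + X 1 ^ (n + 1) * U) (hU : constantCoeff U ≠ 0)
    (hG : constantCoeff G = 0) (hG' : constantCoeff (pderiv 0 G) ≠ 0) : IsTypeA n f Q := by
  have hU₀ : MvPowerSeries.constantCoeff (U : MvPowerSeries (Fin 3) ℂ) ≠ 0 := hU
  have hG₀ : MvPowerSeries.constantCoeff (G : MvPowerSeries (Fin 3) ℂ) = 0 := hG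
  have hG₁ : MvPowerSeries.constantCoeff (MvPowerSeries.pderiv ℂ 0
      (G : MvPowerSeries (Fin 3) ℂ)) ≠ 0 := by
    rwa [MvPowerSeries.pderiv_coe]
  have hinv := MvPowerSeries.inv_mul_cancel _ hU₀
  obtain ⟨z, hz, hquad, hz2⟩ := exists_isFormalCoordinates_sq_add_sq_eq
    (w := (U : MvPowerSeries (Fin 3) ℂ)⁻¹ * G) (by simp [hG₀])
    (by simp [Derivation.leibniz, hG₀, hG₁, hU₀])
  refine ⟨v, hv, z, (U : MvPowerSeries (Fin 3) ℂ)⁻¹, hz, .of_mul_eq_one _ hinv, ?_⟩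
  rw [h, hquad, hz2]
  simp only [coe_add, coe_mul, coe_pow, coe_X]
  linear_combination MvPowerSeries.X 1 ^ (n + 1) * hinv

theorem constantCoeff_aeval_X {σ K : Type*} [CommSemiring K] (q : Polynomial K) (i : σ) :
    constantCoeff (Polynomial.aeval (X i : MvPolynomial σ K) q) = q.eval 0 := by
  rw [← eval_zero, ← aeval_eq_eval, ← Polynomial.aeval_algHom_apply, aeval_X,
    Polynomial.coe_aeval_eq_eval, Pi.zero_apply]

theorem exists_localEquation_eq {e₀ e₂ e₃ : V4} {H : Polynomial ℂ}
    (h : ∀ x y : ℂ, eval (Q.rep + x • e₀ + y • e₂) f = H.eval y) :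
    ∃ G, localEquation f Q ![e₀, e₂, e₃] = X 2 * G + Polynomial.aeval (X 1) H ∧
      constantCoeff G = eval Q.rep (dirDeriv e₃ f) ∧
      constantCoeff (pderiv 0 G) = eval Q.rep (dirDeriv e₀ (dirDeriv e₃ f)) := by
  obtain ⟨G, hF, hG, hG'⟩ := exists_eq_X_two_mul_add_aeval_X_one
    (F := localEquation f Q ![e₀, e₂, e₃]) (H := H) fun x y => by
      rw [eval_localEquation, ← h x y]
      simp [Fin.sum_univ_three, add_assoc]
  refine ⟨G, hF, ?_, ?_⟩
  · rw [← hG, pderiv_localEquation, constantCoeff_localEquation]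
    rfl
  · rw [← hG', pderiv_localEquation, pderiv_localEquation, constantCoeff_localEquation]
    rfl

theorem isTypeA_of_eval_plane_eq {e₀ e₂ e₃ : V4} {q : Polynomial ℂ}
    (hv : LinearIndependent ℂ ![Q.rep, e₀, e₂, e₃])
    (h : ∀ x y : ℂ, eval (Q.rep + x • e₀ + y • e₂) f = y ^ (n + 1) * q.eval y)
    (hq : q.eval 0 ≠ 0) (h₃ : eval Q.rep (dirDeriv e₃ f) = 0)
    (h₀₃ : eval Q.rep (dirDeriv e₀ (dirDeriv e₃ f)) ≠ 0) : IsTypeA n f Q := by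
  obtain ⟨G, hF, hG, hG'⟩ := exists_localEquation_eq (f := f) (Q := Q) (e₀ := e₀)
    (e₂ := e₂) (e₃ := e₃) (H := Polynomial.X ^ (n + 1) * q) fun x y => by simp [h]
  rw [map_mul, map_pow, Polynomial.aeval_X] at hF
  refine isTypeA_of_localEquation_eq hv hF ?_ (hG.trans h₃) (hG' ▸ h₀₃)
  rwa [constantCoeff_aeval_X]

theorem IsTypeA.exists_eval_plane_eq {e₀ e₂ e₃ : V4} {H : Polynomial ℂ} (hQ : IsTypeA n f Q)
    (hf : f.IsHomogeneous (n + 1)) (hn : 2 ≤ n)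
    (h : ∀ x y : ℂ, eval (Q.rep + x • e₀ + y • e₂) f = H.eval y)
    (h₀₃ : eval Q.rep (dirDeriv e₀ (dirDeriv e₃ f)) ≠ 0) (hH : H.natDegree ≤ n + 1) :
    ∃ c : ℂ, ∀ y, H.eval y = c * y ^ (n + 1) := by
  rcases eq_or_ne H 0 with rfl | hH0
  · exact ⟨0, by simp⟩
  obtain ⟨hfQ, hdf⟩ := isSingularPoint_iff.1 (hQ.isSingularPoint hf (by omega))
  obtain ⟨q, hHq, hq⟩ := Polynomial.exists_eq_pow_rootMultiplicity_mul_and_not_dvd H hH0 0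
  rw [map_zero, sub_zero] at hHq hq
  rw [Polynomial.X_dvd_iff, Polynomial.coeff_zero_eq_eval_zero] at hq
  have hm : 1 ≤ H.rootMultiplicity 0 := (Polynomial.rootMultiplicity_pos hH0).2 <| by
    simpa [hfQ] using (h 0 0).symm
  generalize H.rootMultiplicity 0 = m at *
  obtain ⟨G, hF, hG, hG'⟩ := exists_localEquation_eq (e₃ := e₃) h
  have hgerm := hQ.isTypeAGerm_localEquation hf ![e₀, e₂, e₃]
  rw [hF, hHq, map_mul, map_pow, Polynomial.aeval_X, coe_add, coe_mul, coe_mul, coe_pow, coe_X,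
    coe_X] at hgerm
  have hnm : n < m := lt_of_isTypeAGerm (G := (G : MvPowerSeries (Fin 3) ℂ))
    (U := (Polynomial.aeval (X 1) q : MvPolynomial (Fin 3) ℂ)) (hG.trans (hdf e₃))
    (by rw [MvPowerSeries.pderiv_coe]; exact hG' ▸ h₀₃) hn hm
    (MvPowerSeries.isUnit_iff_constantCoeff.2 (isUnit_iff_ne_zero.2
      ((constantCoeff_aeval_X q 1).trans_ne hq)))
    hgerm
  have hq0 : q ≠ 0 := by rintro rfl; simp at hq
  have hdeg : m + q.natDegree ≤ n + 1 := by
    rwa [hHq, Polynomial.natDegree_mul (pow_ne_zero _ Polynomial.X_ne_zero) hq0,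
      Polynomial.natDegree_X_pow] at hH
  obtain rfl : m = n + 1 := by omega
  obtain ⟨c, rfl⟩ := Polynomial.natDegree_eq_zero.1 (by omega : q.natDegree = 0)
  refine ⟨c, fun y => ?_⟩
  rw [hHq, Polynomial.eval_mul, Polynomial.eval_pow, Polynomial.eval_X, Polynomial.eval_C, mul_comm]

end LocalEquation

section AdaptedBasis

theorem exists_basis_of_flag {K V : Type*} [Field K] [AddCommGroup V] [Module K V]
    {L T : Submodule K V} (hL : Module.finrank K L = 2) (hT : Module.finrank K T = 3)
    (hV : Module.finrank K V = 4) (hLT : L ≤ T) {p : V} (hp : p ∈ L) (hp0 : p ≠ 0) :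
    ∃ b : Module.Basis (Fin 4) K V,
      b 0 = p ∧ Submodule.span K {b 0, b 1} = L ∧ b 2 ∈ T ∧ b 3 ∉ T := by
  obtain ⟨e₁, rfl⟩ := exists_span_pair_eq hL hp hp0
  obtain ⟨e₂, he₂T, he₂⟩ := SetLike.exists_of_lt (hLT.lt_of_ne fun h => by rw [h] at hL; omega)
  obtain ⟨e₃, -, he₃⟩ : ∃ e ∈ (⊤ : Submodule K V), e ∉ T :=
    SetLike.exists_of_lt (lt_top_iff_ne_top.2 fun h => by
      rw [h, finrank_top] at hT
      omega)
  have hrange : Set.range ![p, e₁] = {p, e₁} := Matrix.range_cons_cons_empty p e₁ _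
  have hpair : LinearIndependent K ![p, e₁] := by
    rw [linearIndependent_iff_card_eq_finrank_span, Set.finrank, hrange, hL, Fintype.card_fin]
  have hindep : LinearIndependent K
      (Fin.snoc (Fin.snoc ![p, e₁] e₂ : Fin 3 → V) e₃ : Fin 4 → V) := by
    refine linearIndependent_finSnoc.2 ⟨linearIndependent_finSnoc.2 ⟨hpair, ?_⟩, fun h => he₃ ?_⟩
    · rwa [hrange]
    · rw [Fin.range_snoc, hrange] at h
      exact Submodule.span_le.2 (Set.insert_subset he₂T (Submodule.span_le.1 hLT)) h
  have hb := coe_basisOfLinearIndependentOfCardEqFinrank hindep (by simp [hV])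
  refine ⟨basisOfLinearIndependentOfCardEqFinrank hindep (by simp [hV]), ?_⟩
  rw [hb]
  exact ⟨rfl, rfl, he₂T, he₃⟩

variable {f : MvPolynomial (Fin 4) ℂ} {P Q : P3} {L : Submodule ℂ V4}
  {b : Module.Basis (Fin 4) ℂ V4}

theorem finrank_tangentSpaceAt (hP : IsSmoothPoint f P) :
    Module.finrank ℂ (tangentSpaceAt f P) = 3 := by
  obtain ⟨i, hi⟩ := hP.2
  have hne : (∑ i, eval P.rep (pderiv i f) • (LinearMap.proj i : V4 →ₗ[ℂ] ℂ)) ≠ 0 := fun h =>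
    hi (by simpa [LinearMap.sum_apply, Pi.single_apply] using
      LinearMap.congr_fun h (Pi.single i 1))
  have hker := Module.Dual.finrank_ker_add_one_of_ne_zero hne
  rw [Module.finrank_fin_fun] at hker
  exact Nat.succ_injective hker

/-- The basis `b` of `ℂ⁴` is adapted to the flag formed by the point `P`, the line `L` and the
tangent plane at `P` of the surface `f = 0`. -/
structure IsAdaptedBasis (f : MvPolynomial (Fin 4) ℂ) (P : P3) (L : Submodule ℂ V4)
    (b : Module.Basis (Fin 4) ℂ V4) : Prop where
  apply_zero : b 0 = P.rep
  span_eq : Submodule.span ℂ {b 0, b 1} = L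
  le_tangentSpaceAt : L ≤ tangentSpaceAt f P
  apply_two_mem : b 2 ∈ tangentSpaceAt f P
  apply_three_notMem : b 3 ∉ tangentSpaceAt f P

theorem exists_isAdaptedBasis (hP : IsSmoothPoint f P) (hL : Module.finrank ℂ L = 2)
    (hPL : LiesOn P L) (hLT : L ≤ tangentSpaceAt f P) : ∃ b, IsAdaptedBasis f P L b := by
  obtain ⟨b, h₀, hspan, h₂, h₃⟩ := exists_basis_of_flag hL (finrank_tangentSpaceAt hP)
    (Module.finrank_fin_fun ℂ) hLT (liesOn_iff.1 hPL) P.rep_nonzero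
  exact ⟨b, h₀, hspan, hLT, h₂, h₃⟩

namespace IsAdaptedBasis

theorem eval_dirDeriv_ne_zero (hb : IsAdaptedBasis f P L b) :
    eval P.rep (dirDeriv (b 3) f) ≠ 0 := fun h =>
  hb.apply_three_notMem (mem_tangentSpaceAt.2 h)

theorem repr_two_eq_zero (hb : IsAdaptedBasis f P L b) {v : V4} (hv : v ∈ L) :
    b.repr v 2 = 0 := by
  rw [← hb.span_eq] at hv
  obtain ⟨x, y, rfl⟩ := Submodule.mem_span_pair.1 hv
  simp

theorem repr_one_ne_zero (hb : IsAdaptedBasis f P L b) (hQL : LiesOn Q L) (hPQ : P ≠ Q) :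
    b.repr Q.rep 1 ≠ 0 := fun h => by
  rw [liesOn_iff, ← hb.span_eq] at hQL
  obtain ⟨x, y, hxy⟩ := Submodule.mem_span_pair.1 hQL
  have hy : y = 0 := by simpa [← hxy] using h
  rw [hy, zero_smul, add_zero, hb.apply_zero] at hxy
  have hindep := LinearIndependent.pair_iff.1 (linearIndependent_rep_pair hPQ)
  exact neg_ne_zero.2 one_ne_zero (hindep x (-1) (by rw [hxy, neg_one_smul, add_neg_cancel])).2

end IsAdaptedBasis

theorem linearIndependent_of_repr_one_ne_zero {K V : Type*} [Field K] [AddCommGroup V]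
    [Module K V] (b : Module.Basis (Fin 4) K V) {v : V} (hv : b.repr v 1 ≠ 0) :
    LinearIndependent K ![v, b 0, b 2, b 3] := by
  have hcomp : ![b 0, b 2, b 3] = b ∘ ![0, 2, 3] := by
    funext i
    fin_cases i <;> rfl
  refine linearIndependent_finCons.2 ⟨?_, fun hmem => ?_⟩
  · rw [hcomp]
    exact b.linearIndependent.comp _ (by decide)
  · rw [hcomp, Set.range_comp, b.mem_span_image] at hmem
    simpa using hmem (Finsupp.mem_support_iff.2 hv)

end AdaptedBasis

section Perturbation

/-- The linear functional `ξ` as a form of degree one. -/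
def linearForm {σ K : Type*} [Fintype σ] [DecidableEq σ] [CommSemiring K] (ξ : (σ → K) →ₗ[K] K) :
    MvPolynomial σ K :=
  ∑ j, C (ξ (Pi.single j 1)) * X j

section LinearForm

variable {σ K : Type*} [Fintype σ] [DecidableEq σ] [CommSemiring K] (ξ : (σ → K) →ₗ[K] K)

theorem isHomogeneous_linearForm : (linearForm ξ).IsHomogeneous 1 :=
  IsHomogeneous.sum _ _ _ fun _ _ => isHomogeneous_C_mul_X _ _

theorem eval_linearForm (v : σ → K) : eval v (linearForm ξ) = ξ v := by
  conv_rhs => rw [pi_eq_sum_univ' v]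
  simp [linearForm, mul_comm]

theorem dirDeriv_linearForm (v : σ → K) : dirDeriv v (linearForm ξ) = C (ξ v) := by
  rw [← eval_linearForm]
  simp [linearForm, Derivation.leibniz, mul_comm]

end LinearForm

variable {b : Module.Basis (Fin 4) ℂ V4} {n : ℕ} {Q : P3}

/-- The form `x₂ⁿ x₁`, where `x₁` and `x₂` are coordinates with respect to the basis `b`. -/
def perturbation (b : Module.Basis (Fin 4) ℂ V4) (n : ℕ) : MvPolynomial (Fin 4) ℂ :=
  linearForm (b.coord 2) ^ n * linearForm (b.coord 1)

theorem isHomogeneous_perturbation : (perturbation b n).IsHomogeneous (n + 1) := by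
  simpa [perturbation] using
    ((isHomogeneous_linearForm _).pow n).mul (isHomogeneous_linearForm _)

theorem eval_perturbation (v : V4) :
    eval v (perturbation b n) = b.repr v 2 ^ n * b.repr v 1 := by
  simp [perturbation, eval_linearForm]

theorem dirDeriv_three_perturbation : dirDeriv (b 3) (perturbation b n) = 0 := by
  simp [perturbation, Derivation.leibniz, Derivation.leibniz_pow, dirDeriv_linearForm]

theorem isSingularPoint_perturbation (hn : 2 ≤ n) (hQ : b.repr Q.rep 2 = 0) :
    IsSingularPoint (perturbation b n) Q := by
  refine isSingularPoint_iff.2 ⟨?_, fun v => ?_⟩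
  · simp [eval_perturbation, hQ, show n ≠ 0 by omega]
  · simp [perturbation, Derivation.leibniz, Derivation.leibniz_pow, eval_linearForm, hQ,
      show n ≠ 0 by omega, show n - 1 ≠ 0 by omega]

end Perturbation

section Deformation

variable {f ψ : MvPolynomial (Fin 4) ℂ} {P Q : P3} {L : Submodule ℂ V4}
  {b : Module.Basis (Fin 4) ℂ V4} {d n : ℕ}

theorem eval_pderiv_add (hψ : IsSingularPoint ψ P) (i : Fin 4) :
    eval P.rep (pderiv i (f + ψ)) = eval P.rep (pderiv i f) := by
  rw [map_add, map_add, hψ.2, add_zero]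

theorem tangentSpaceAt_add (hψ : IsSingularPoint ψ P) :
    tangentSpaceAt (f + ψ) P = tangentSpaceAt f P := by
  simp only [tangentSpaceAt, eval_pderiv_add hψ]

theorem IsSmoothStarPoint.add (hP : IsSmoothStarPoint f P) (hψ : IsSingularPoint ψ P)
    (hinv : ∀ v (c : ℂ), eval (v + c • P.rep) ψ = eval v ψ) : IsSmoothStarPoint (f + ψ) P := by
  obtain ⟨⟨hPf, i, hi⟩, hPT, hcone⟩ := hP
  refine ⟨⟨by rw [map_add, hPf, hψ.1, add_zero], i, by rwa [eval_pderiv_add hψ]⟩, ?_⟩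
  rw [tangentSpaceAt_add hψ]
  exact ⟨hPT, fun v hv c => by rw [map_add, map_add, hcone v hv, hinv]⟩

theorem IsSmoothPoint.ne_zero (hP : IsSmoothPoint f P) : f ≠ 0 := by
  rintro rfl
  obtain ⟨i, hi⟩ := hP.2
  simp at hi

theorem IsSmoothStarPoint.irreducible (hP : IsSmoothStarPoint f P) (hf : f.IsHomogeneous d)
    {v : V4} (hv : v ∈ tangentSpaceAt f P) (hfv : eval v f ≠ 0) : Irreducible f := by
  obtain ⟨i, hi⟩ := hP.1.2
  exact irreducible_of_smooth_of_invariant hf hP.1.1 (e := Pi.single i 1)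
    (by rwa [← pderiv_eq_dirDeriv]) (hP.2.2 v hv) hfv

theorem typeAOn_subset_singularPointsOn (hf : f.IsHomogeneous d) (hn : 1 ≤ n) :
    typeAOn n f L ⊆ singularPointsOn f L := fun _ hQ => ⟨hQ.1, hQ.2.isSingularPoint hf hn⟩

namespace IsAdaptedBasis

theorem eval_dirDeriv_dirDeriv_ne_zero (hb : IsAdaptedBasis f P L b) (hf : f.IsHomogeneous d)
    (hL : Module.finrank ℂ L = 2) (hPL : LiesOn P L)
    (hcard : (d - 1 : ℕ) ≤ (singularPointsOn f L).encard) (hQ : Q ∈ singularPointsOn f L) :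
    eval Q.rep (dirDeriv (b 0) (dirDeriv (b 3) f)) ≠ 0 := by
  have hsub : singularPointsOn f L ⊆ zerosOn (dirDeriv (b 3) f) L := fun Q hQ =>
    ⟨hQ.1, (isSingularPoint_iff.1 hQ.2).2 _⟩
  rw [hb.apply_zero]
  exact eval_dirDeriv_ne_zero_of_le_encard_zerosOn (isHomogeneous_dirDeriv hf _) hL hPL
    hb.eval_dirDeriv_ne_zero (hcard.trans (Set.encard_le_encard hsub)) (hsub hQ)

variable (hb : IsAdaptedBasis f P L b)
include hb

theorem isSingularPoint_C_mul_perturbation (hn : 2 ≤ n) (hQL : LiesOn Q L) (t : ℂ) :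
    IsSingularPoint (C t * perturbation b n) Q := by
  obtain ⟨hzero, hderiv⟩ := isSingularPoint_perturbation hn (hb.repr_two_eq_zero (liesOn_iff.1 hQL))
  exact ⟨by rw [map_mul, hzero, mul_zero], fun i => by
    rw [pderiv_C_mul, map_mul, hderiv, mul_zero]⟩

theorem isSmoothStarPoint_add_perturbation (hn : 2 ≤ n) (hPL : LiesOn P L)
    (hP : IsSmoothStarPoint f P) (t : ℂ) : IsSmoothStarPoint (f + C t * perturbation b n) P := by
  refine hP.add (hb.isSingularPoint_C_mul_perturbation hn hPL t) fun v c => ?_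
  simp [eval_perturbation, ← hb.apply_zero]

theorem exists_eval_plane_add_perturbation (hn : 1 ≤ n) (hf : f.IsHomogeneous (n + 2))
    (hP : IsSmoothStarPoint f P) (hQ : Q ∈ typeAOn (n + 1) f L)
    (hmix : eval Q.rep (dirDeriv (b 0) (dirDeriv (b 3) f)) ≠ 0) :
    ∃ β c : ℂ, β ≠ 0 ∧ ∀ t x y : ℂ,
      eval (Q.rep + x • b 0 + y • b 2) (f + C t * perturbation b (n + 1)) =
        y ^ (n + 1) * (t * β + c * y) := by
  obtain ⟨hQL, hQA⟩ := hQ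
  have hQ₂ : b.repr Q.rep 2 = 0 := hb.repr_two_eq_zero (liesOn_iff.1 hQL)
  have hPQ : P ≠ Q := by
    rintro rfl
    exact hP.1.not_isSingularPoint (hQA.isSingularPoint hf (by omega))
  have hcone (x y : ℂ) :
      eval (Q.rep + x • b 0 + y • b 2) f = (lineRestrict f Q.rep (b 2)).eval y := by
    rw [eval_lineRestrict, add_right_comm, hb.apply_zero]
    exact hP.2.2 _ (Submodule.add_mem _ (hb.le_tangentSpaceAt (liesOn_iff.1 hQL))
      (Submodule.smul_mem _ y hb.apply_two_mem)) x
  obtain ⟨c, hc⟩ := hQA.exists_eval_plane_eq hf (by omega) hcone hmix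
    (natDegree_lineRestrict_le hf Q.rep (b 2))
  refine ⟨b.repr Q.rep 1, c, hb.repr_one_ne_zero hQL hPQ, fun t x y => ?_⟩
  have hcoord : b.repr (Q.rep + x • b 0 + y • b 2) 1 = b.repr Q.rep 1 := by simp
  have hcoord' : b.repr (Q.rep + x • b 0 + y • b 2) 2 = y := by simp [hQ₂]
  rw [map_add, map_mul, eval_C, hcone, hc, eval_perturbation, hcoord, hcoord']
  ring

theorem isTypeA_add_perturbation (hn : 1 ≤ n) (hf : f.IsHomogeneous (n + 2))
    (hP : IsSmoothStarPoint f P) (hQ : Q ∈ typeAOn (n + 1) f L)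
    (hmix : eval Q.rep (dirDeriv (b 0) (dirDeriv (b 3) f)) ≠ 0) {t : ℂ} (ht : t ≠ 0) :
    IsTypeA n (f + C t * perturbation b (n + 1)) Q := by
  obtain ⟨β, c, hβ, hplane⟩ := hb.exists_eval_plane_add_perturbation hn hf hP hQ hmix
  have hsing := hQ.2.isSingularPoint hf (by omega)
  have hPQ : P ≠ Q := by
    rintro rfl
    exact hP.1.not_isSingularPoint hsing
  have hderiv : dirDeriv (b 3) (f + C t * perturbation b (n + 1)) = dirDeriv (b 3) f := by
    simp [Derivation.leibniz, dirDeriv_three_perturbation]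
  refine isTypeA_of_eval_plane_eq (q := Polynomial.C (t * β) + Polynomial.C c * Polynomial.X)
    (linearIndependent_of_repr_one_ne_zero b (hb.repr_one_ne_zero hQ.1 hPQ))
    (fun x y => by simp [hplane]) (by simp [ht, hβ]) ?_ ?_
  · rw [hderiv]
    exact (isSingularPoint_iff.1 hsing).2 _
  · rwa [hderiv]

theorem encard_typeAOn_add_perturbation (hn : 1 ≤ n) (hf : f.IsHomogeneous (n + 2))
    (hL : Module.finrank ℂ L = 2) (hPL : LiesOn P L) (hP : IsSmoothStarPoint f P)
    (hcard : (n + 1 : ℕ) ≤ (typeAOn (n + 1) f L).encard)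
    (hmix : ∀ Q ∈ typeAOn (n + 1) f L, eval Q.rep (dirDeriv (b 0) (dirDeriv (b 3) f)) ≠ 0)
    {t : ℂ} (ht : t ≠ 0) :
    (typeAOn n (f + C t * perturbation b (n + 1)) L).encard = (n + 1 : ℕ) := by
  have hfX : (f + C t * perturbation b (n + 1)).IsHomogeneous (n + 2) :=
    hf.add (isHomogeneous_perturbation.C_mul t)
  have hPX := hb.isSmoothStarPoint_add_perturbation (n := n + 1) (by omega) hPL hP t
  refine le_antisymm ((Set.encard_le_encard (typeAOn_subset_singularPointsOn hfX hn)).trans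
    (encard_singularPointsOn_le hfX hL hPL hPX.1)) (hcard.trans (Set.encard_le_encard ?_))
  exact fun Q hQ => ⟨hQ.1, hb.isTypeA_add_perturbation hn hf hP hQ (hmix Q hQ) ht⟩

theorem irreducible_add_perturbation (hn : 1 ≤ n) (hf : f.IsHomogeneous (n + 2))
    (hPL : LiesOn P L) (hP : IsSmoothStarPoint f P) (hQ : Q ∈ typeAOn (n + 1) f L)
    (hmix : eval Q.rep (dirDeriv (b 0) (dirDeriv (b 3) f)) ≠ 0) {t : ℂ} (ht : t ≠ 0) :
    Irreducible (f + C t * perturbation b (n + 1)) := by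
  obtain ⟨β, c, hβ, hplane⟩ := hb.exists_eval_plane_add_perturbation hn hf hP hQ hmix
  obtain ⟨y, hy⟩ : ∃ y : ℂ, y ^ (n + 1) * (t * β + c * y) ≠ 0 := by
    by_contra! h
    have hneg := (mul_eq_zero.1 (h (-1))).resolve_left (pow_ne_zero _ (by norm_num))
    exact mul_ne_zero ht hβ (by linear_combination h 1 / 2 + hneg / 2)
  have hn' : 2 ≤ n + 1 := by omega
  refine (hb.isSmoothStarPoint_add_perturbation hn' hPL hP t).irreducible
    (hf.add (isHomogeneous_perturbation.C_mul t)) (v := Q.rep + y • b 2) ?_ ?_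
  · rw [tangentSpaceAt_add (hb.isSingularPoint_C_mul_perturbation hn' hPL t)]
    exact Submodule.add_mem _ (hb.le_tangentSpaceAt (liesOn_iff.1 hQ.1))
      (Submodule.smul_mem _ y hb.apply_two_mem)
  · simpa [← hplane t 0 y] using hy

end IsAdaptedBasis

theorem exists_tripleFamily (hf : f.IsHomogeneous d) (hψ : ψ.IsHomogeneous d)
    (h : ∀ t : ℂ, f + C t * ψ ≠ 0) (hL : Module.finrank ℂ L = 2) (P : P3) :
    ∃ F : TripleFamily d, ∀ t, F.X t = f + C t * ψ ∧ F.line t = L ∧ F.point t = P := by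
  have hmap (t : ℂ) : map (Polynomial.evalRingHom t)
      (map Polynomial.C f + C Polynomial.X * map Polynomial.C ψ) = f + C t * ψ := by
    have hcomp : (Polynomial.evalRingHom t).comp Polynomial.C = RingHom.id ℂ := by ext; simp
    simp [map_map, hcomp, MvPolynomial.map_id]
  have : FiniteDimensional ℂ L := .of_finrank_pos (by omega)
  let e : Module.Basis (Fin 2) ℂ L := Module.finBasisOfFinrankEq ℂ L hL
  refine ⟨{
    form := map Polynomial.C f + C Polynomial.X * map Polynomial.C ψ
    isHomogeneous := (hf.map _).add ((hψ.map _).C_mul _)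
    form_ne_zero := fun t => by rw [hmap]; exact h t
    lineVec := fun k i => Polynomial.C ((e k : V4) i)
    line_indep := fun t => by
      simpa [Function.comp_def] using e.linearIndependent.map' L.subtype L.ker_subtype
    pointVec := fun i => Polynomial.C (P.rep i)
    point_ne_zero := fun t => by simpa using P.rep_nonzero }, fun t => ⟨hmap t, ?_, ?_⟩⟩
  · have hspan := congrArg (Submodule.map L.subtype) e.span_eq
    rw [Submodule.map_span, ← Set.range_comp, Submodule.map_subtype_top] at hspan
    simpa [TripleFamily.line, Function.comp_def] using hspan
  · simp [TripleFamily.point, P.mk_rep]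

end Deformation

end

theorem mainTheorem9 (d : ℕ) (hd : 3 ≤ d)
    (f : MvPolynomial (Fin 4) ℂ) (hf : f.IsHomogeneous d)
    (L : Submodule ℂ V4) (hL : Module.finrank ℂ L = 2)
    (hLsing : ¬ ∀ Q : P3, LiesOn Q L → IsSingularPoint f Q)
    (hA : ((d - 1 : ℕ) : ℕ∞) ≤ (typeAOn (d - 1) f L).encard)
    (P : P3) (hPL : LiesOn P L) (hP : IsSmoothStarPoint f P) :
    ∃ F : TripleFamily d,
      F.X 0 = f ∧ F.line 0 = L ∧ F.point 0 = P ∧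
      ∀ t : ℂ, t ≠ 0 →
        Irreducible (F.X t) ∧
        (typeAOn (d - 2) (F.X t) (F.line t)).encard = ((d - 1 : ℕ) : ℕ∞) ∧
        LiesOn (F.point t) (F.line t) ∧
        IsSmoothStarPoint (F.X t) (F.point t) := by
  obtain ⟨n, rfl⟩ : ∃ n, d = n + 2 := ⟨d - 2, by omega⟩
  have hn : 1 ≤ n := by omega
  have hsing : typeAOn (n + 1) f L ⊆ singularPointsOn f L :=
    typeAOn_subset_singularPointsOn hf (by omega)
  have hcard := hA.trans (Set.encard_le_encard hsing)
  obtain ⟨b, hb⟩ := exists_isAdaptedBasis hP.1 hL hPL <| le_tangentSpaceAt_of_eval_eq_zero hPL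
    fun _ => eval_eq_zero_of_le_encard_singularPointsOn (by omega) hf hL hPL hP.1 hcard
  have hmix (Q : P3) (hQ : Q ∈ typeAOn (n + 1) f L) :=
    hb.eval_dirDeriv_dirDeriv_ne_zero hf hL hPL hcard (hsing hQ)
  have hstar := hb.isSmoothStarPoint_add_perturbation (n := n + 1) (by omega) hPL hP
  obtain ⟨F, hF⟩ := exists_tripleFamily hf isHomogeneous_perturbation
    (fun t => (hstar t).1.ne_zero) hL P
  refine ⟨F, by simp [hF], (hF 0).2.1, (hF 0).2.2, fun t ht => ?_⟩
  obtain ⟨hX, hline, hpoint⟩ := hF t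
  rw [hX, hline, hpoint]
  obtain ⟨Q, hQ⟩ : (typeAOn (n + 1) f L).Nonempty :=
    Set.encard_pos.1 (lt_of_lt_of_le (by simp) hA)
  exact ⟨hb.irreducible_add_perturbation hn hf hPL hP hQ (hmix Q hQ) ht,
    hb.encard_typeAOn_add_perturbation hn hf hL hPL hP hA hmix ht, hPL, hstar t⟩
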